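/- Let $k$ be a field of characteristic $2$ and let $d, r \ge 0$ be integers with $d \ge 2r$. For a partition $\lambda$ of $n$, let $S^\lambda$ denote the Specht module over $k\Sigma_n$, i.e. the $k$-span of the polytabloids inside the permutation module $M^\lambda$ on the $\lambda$-tabloids. Then: (1) $\dim_k \operatorname{Hom}_{k\Sigma_d}\bigl(S^{(d-r,1^r)}, S^{(d-r,1^r)}\bigr) = \dim_k \operatorname{Hom}_{k\Sigma_{d+2}}\bigl(S^{(d-r+2,1^r)}, S^{(d-r+2,1^r)}\bigr)$. (2) If $L \ge 1$ is an integer with $2^{L-1} \le r < 2^L$, then the $k\Sigma_d$-module $S^{(d-r,1^r)}$ is indecomposable if and only if the $k\Sigma_{d+2^L}$-module $S^{(d-r+2^L,1^r)}$ is indecomposable. -/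

import Mathlib

/-- The hook diagram of the partition `(a, 1^r)`; it is a partition as soon as `r = 0` or `1 ≤ a`. -/
def hookDiagram (a r : ℕ) (h : r = 0 ∨ 1 ≤ a) : YoungDiagram :=
  YoungDiagram.ofRowLens (a :: List.replicate r 1) (by
    rw [List.sortedGE_iff_pairwise, List.pairwise_cons]
    refine ⟨fun b hb => ?_, List.pairwise_replicate.2 (Or.inr le_rfl)⟩
    rw [List.mem_replicate] at hb
    omega)

/-- A `μ`-tableau with entries `0, …, n-1`, each used exactly once
(there are none unless `μ` has `n` boxes). The box `c` carries the entry `t c`. -/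
abbrev Tableau (μ : YoungDiagram) (n : ℕ) : Type :=
  μ.cells ≃ Fin n

namespace Tableau

variable {μ : YoungDiagram} {n : ℕ}

/-- The row of `t` that contains the entry `x`. -/
def row (t : Tableau μ n) (x : Fin n) : ℕ :=
  (t.symm x).1.1

/-- The column of `t` that contains the entry `x`. -/
def col (t : Tableau μ n) (x : Fin n) : ℕ :=
  (t.symm x).1.2

/-- The column stabilizer of `t`: the permutations that keep every entry in its column. -/
def colStabilizer (t : Tableau μ n) : Finset (Equiv.Perm (Fin n)) :=
  {σ | ∀ x, t.col (σ x) = t.col x}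

theorem card_row_eq (t : Tableau μ n) (i : ℕ) :
    (Finset.univ.filter fun x => t.row x = i).card = μ.rowLen i := by
  rw [YoungDiagram.rowLen_eq_card]
  refine Finset.card_bij (fun x _ => (t.symm x).1) ?_ ?_ ?_
  · intro x hx
    rw [YoungDiagram.mem_row_iff]
    exact ⟨(t.symm x).2, (Finset.mem_filter.1 hx).2⟩
  · intro x _ y _ hxy
    exact t.symm.injective (Subtype.ext hxy)
  · intro c hc
    rw [YoungDiagram.mem_row_iff] at hc
    refine ⟨t ⟨c, hc.1⟩, Finset.mem_filter.2 ⟨Finset.mem_univ _, ?_⟩, ?_⟩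
    · rw [row, Equiv.symm_apply_apply]
      exact hc.2
    · rw [Equiv.symm_apply_apply]

end Tableau

/-- A `μ`-tabloid (a row-equivalence class of `μ`-tableaux): an assignment of the entries
`0, …, n-1` to rows such that row `i` receives `μ.rowLen i` entries. -/
@[ext]
structure Tabloid (μ : YoungDiagram) (n : ℕ) where
  row : Fin n → ℕ
  card_row_eq : ∀ i, (Finset.univ.filter fun x => row x = i).card = μ.rowLen i

/-- The tabloid `{t}` of a tableau `t`. -/
def Tableau.tabloid {μ : YoungDiagram} {n : ℕ} (t : Tableau μ n) : Tabloid μ n :=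
  ⟨t.row, t.card_row_eq⟩

namespace Tabloid

variable {μ : YoungDiagram} {n : ℕ}

/-- The symmetric group acts on tabloids by permuting the entries: the entry `σ x` lies in the row
of `σ • T` in which `x` lies in `T`. -/
instance : MulAction (Equiv.Perm (Fin n)) (Tabloid μ n) where
  smul σ T := ⟨fun x => T.row (σ⁻¹ x), fun i => by
    rw [← T.card_row_eq i]
    exact Finset.card_bij (fun x _ => σ⁻¹ x) (by simp) (by simp)
      fun x hx => ⟨σ x, by simpa using hx, by simp⟩⟩
  one_smul _ := rfl
  mul_smul σ τ T := by
    apply Tabloid.ext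
    funext x
    change T.row ((σ * τ)⁻¹ x) = T.row (τ⁻¹ (σ⁻¹ x))
    rw [mul_inv_rev, Equiv.Perm.mul_apply]

theorem smul_row (σ : Equiv.Perm (Fin n)) (T : Tabloid μ n) (x : Fin n) :
    (σ • T).row x = T.row (σ⁻¹ x) := rfl

theorem row_lt (T : Tabloid μ n) (x : Fin n) : T.row x < μ.colLen 0 := by
  have h : 0 < μ.rowLen (T.row x) := by
    rw [← T.card_row_eq]
    exact Finset.card_pos.2 ⟨x, by simp⟩
  rwa [← YoungDiagram.mem_iff_lt_rowLen, YoungDiagram.mem_iff_lt_colLen] at h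

instance : Finite (Tabloid μ n) :=
  Finite.of_injective
    (fun (T : Tabloid μ n) (x : Fin n) => (⟨T.row x, T.row_lt x⟩ : Fin (μ.colLen 0)))
    fun T T' h => by
      apply Tabloid.ext
      funext x
      exact congrArg Fin.val (congrFun h x)

end Tabloid

noncomputable section

variable (k : Type*) [Field k] (μ : YoungDiagram) (n : ℕ)

/-- The permutation module `M^μ` over `k`, with the tabloids as a basis. -/
def tabloidRep : Representation k (Equiv.Perm (Fin n)) (Tabloid μ n →₀ k) where
  toFun σ := Finsupp.lmapDomain k k fun T => σ • T
  map_one' := by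
    ext1 T
    ext1
    simp
  map_mul' σ τ := by
    ext1 T
    ext1
    simp [mul_smul]

variable {μ n}

/-- The polytabloid `e_t`, the sum of `sgn(σ) σ{t}` over the column stabilizer of `t`. -/
def polytabloid (t : Tableau μ n) : Tabloid μ n →₀ k :=
  ∑ σ ∈ t.colStabilizer,
    ((Equiv.Perm.sign σ : ℤ) : k) • Finsupp.single (σ • t.tabloid) (1 : k)

theorem tabloidRep_single (σ : Equiv.Perm (Fin n)) (T : Tabloid μ n) (a : k) :
    tabloidRep k μ n σ (Finsupp.single T a) = Finsupp.single (σ • T) a :=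
  Finsupp.mapDomain_single

theorem tabloidRep_polytabloid (τ : Equiv.Perm (Fin n)) (t : Tableau μ n) :
    tabloidRep k μ n τ (polytabloid k t) = polytabloid k (t.trans τ) := by
  have htab : Tableau.tabloid (t.trans τ : Tableau μ n) = τ • t.tabloid := rfl
  have hcol (x) : Tableau.col (t.trans τ : Tableau μ n) x = t.col (τ⁻¹ x) := rfl
  simp only [polytabloid, map_sum, map_smul, tabloidRep_single, htab]
  refine Finset.sum_bij (fun σ _ => τ * σ * τ⁻¹) ?_ ?_ ?_ ?_
  · intro σ hσ
    simp only [Tableau.colStabilizer, Finset.mem_filter, Finset.mem_univ, true_and, hcol] at hσ ⊢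
    intro x
    simpa using hσ (τ⁻¹ x)
  · intro σ _ σ' _ h
    simpa using h
  · intro σ hσ
    refine ⟨τ⁻¹ * σ * τ, ?_, by group⟩
    simp only [Tableau.colStabilizer, Finset.mem_filter, Finset.mem_univ, true_and, hcol] at hσ ⊢
    intro x
    simpa using hσ (τ x)
  · intro σ _
    have hs : Equiv.Perm.sign (τ * σ * τ⁻¹) = Equiv.Perm.sign σ := by
      rw [map_mul, map_mul, map_inv, mul_right_comm, mul_inv_cancel, one_mul]
    rw [hs, smul_smul, smul_smul, inv_mul_cancel_right]

variable (μ n)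

/-- The Specht module `S^μ` as a submodule of `M^μ`: the span of the polytabloids. -/
def spechtSubrep : Subrepresentation (tabloidRep k μ n) where
  toSubmodule := Submodule.span k (Set.range fun t : Tableau μ n => polytabloid k t)
  apply_mem_toSubmodule τ v hv := by
    induction hv using Submodule.span_induction with
    | mem _ h =>
      obtain ⟨t, rfl⟩ := h
      rw [tabloidRep_polytabloid]
      exact Submodule.subset_span ⟨_, rfl⟩
    | zero => rw [map_zero]; exact zero_mem _
    | add _ _ _ _ hx hy => rw [map_add]; exact add_mem hx hy
    | smul a _ _ hx => rw [map_smul]; exact Submodule.smul_mem _ a hx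

/-- The vector space underlying the Specht module `S^μ` over `k`. -/
def SpechtModule : Type _ :=
  (spechtSubrep k μ n).toSubmodule

instance : AddCommGroup (SpechtModule k μ n) :=
  inferInstanceAs (AddCommGroup (spechtSubrep k μ n).toSubmodule)

instance : Module k (SpechtModule k μ n) :=
  inferInstanceAs (Module k (spechtSubrep k μ n).toSubmodule)

instance : Module.Finite k (SpechtModule k μ n) :=
  inferInstanceAs (Module.Finite k (spechtSubrep k μ n).toSubmodule)

/-- The Specht module `S^μ` over `k` as a representation of the symmetric group on `n` letters,
for a partition `μ` of `n`. -/
def spechtRep : Representation k (Equiv.Perm (Fin n)) (SpechtModule k μ n) :=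
  (spechtSubrep k μ n).toRepresentation

end

/-- A representation is indecomposable if it is nonzero and is not the direct sum of two nonzero
subrepresentations. -/
def Representation.IsIndecomposable {k G V : Type*} [Field k] [Group G] [AddCommGroup V]
    [Module k V] (ρ : Representation k G V) : Prop :=
  Nontrivial V ∧ ∀ U W : Subrepresentation ρ, IsCompl U W → U = ⊥ ∨ W = ⊥

/-! In characteristic 2 signs disappear. The polytabloid of a hook tableau with first column `X`,
`#X = r + 1`, becomes the sum of all tabloids whose entries below the first row form an `r`-subset
of `X`. Hence the Specht module is the space spanned by the boundaries `∂X` in the mod 2 chain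
complex of the full simplex on `d` points (`exists_isBoundaryModel_spechtRep`; degree 0 is
separate).

For even `d`, an endomorphism sends `∂X` to a function whose value at `Y` depends only on `#(X ∩
Y)`. The image is a cycle, and `∂∂ = 0` must be respected; the two resulting recurrences kill every
coefficient except that of `Y ⊆ X`. So the endomorphism ring is `k` (`exists_eq_smul_id_of_even`),
and both claims follow because `d + 2` and `d + 2^L` are even too.

For odd `d`, the identity `∂δ + δ∂ = d` (`boundary_coboundary_add`) makes `e = ∂δ` an equivariant
projection from functions on `r`-subsets to boundaries. The endomorphism ring is then the corner
`eAe` of the Johnson scheme algebra `A` (`exists_linearEquiv_johnsonCorner`). Elements of `A` are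
coefficient sequences indexed by intersection sizes, so different `d` can be compared. Adding `N`
points changes a product only by terms with a factor `N.choose m`, `0 < m ≤ r` (`sum_mul_map_eq`).
For `N = 2`, products with `e` involve only `m = 1`, since `e` is supported on intersections of size
at least `r - 1`; so the corner is unchanged as a vector space. For `N = 2^L > r` all these
binomials are even, so the multiplication and its idempotents are unchanged as well. -/

open Finset

/-! ### The mod 2 chain complex of a simplex. -/

section SubsetModule

set_option linter.unusedSectionVars false

variable {k : Type*} [Field k] {α : Type*} [Fintype α] [DecidableEq α]

/-- Two pairs of finsets with the same cardinalities and the same cardinality of the intersection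
are conjugate under the symmetric group. -/
theorem Finset.exists_perm_map_eq {X Y X' Y' : Finset α} (hX : #X = #X') (hY : #Y = #Y')
    (hXY : #(X ∩ Y) = #(X' ∩ Y')) :
    ∃ g : Equiv.Perm α, X.map g.toEmbedding = X' ∧ Y.map g.toEmbedding = Y' := by
  have key (A B A' B' : Finset α) (h : #A = #A') (h' : #(A ∩ B) = #(A' ∩ B')) :
      #(A \ B) = #(A' \ B') := by
    have h1 := card_sdiff_add_card_inter A B
    have h2 := card_sdiff_add_card_inter A' B'
    omega
  have h10 := key X Y X' Y' hX hXY
  have h01 := key Y X Y' X' hY (by rwa [inter_comm, inter_comm Y'])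
  have h00 : #(X ∪ Y)ᶜ = #(X' ∪ Y')ᶜ := by
    have h1 := card_union_add_card_inter X Y
    have h2 := card_union_add_card_inter X' Y'
    rw [card_compl, card_compl]
    omega
  -- The membership pattern splits `α` into four fibres; the two pairs have fibres of equal size,
  -- and bijections between the fibres glue to `g`.
  let f (A B : Finset α) (x : α) : Prop × Prop := (x ∈ A, x ∈ B)
  have hf (c : Prop × Prop) : Nonempty ({x // f X Y x = c} ≃ {x // f X' Y' x = c}) := by
    classical
    rw [← Fintype.card_eq, Fintype.card_subtype, Fintype.card_subtype]
    obtain ⟨p, q⟩ := c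
    have e (A B : Finset α) : (univ.filter fun x => f A B x = (p, q)) =
        if p then (if q then A ∩ B else A \ B) else if q then B \ A else (A ∪ B)ᶜ := by
      ext x
      by_cases hp : p <;> by_cases hq : q <;> simp [f, hp, hq, and_comm]
    rw [e, e]
    split_ifs <;> assumption
  let g : Equiv.Perm α := Equiv.ofFiberEquiv fun c => (hf c).some
  have hg (x : α) : f X' Y' (g x) = f X Y x := Equiv.ofFiberEquiv_map _ x
  refine ⟨g, ?_, ?_⟩
  · ext x
    have := congrArg Prod.fst (hg (g.symm x))
    simp only [f, Equiv.apply_symm_apply] at this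
    rw [mem_map_equiv, this]
  · ext x
    have := congrArg Prod.snd (hg (g.symm x))
    simp only [f, Equiv.apply_symm_apply] at this
    rw [mem_map_equiv, this]

variable (k α)

/-- The symmetric group acts on functions of subsets by permuting the subsets. -/
def subsetRep : Representation k (Equiv.Perm α) (Finset α → k) where
  toFun g := LinearMap.funLeft k k fun Y => Y.map g.symm.toEmbedding
  map_one' := by
    refine LinearMap.ext fun f => funext fun Y => ?_
    exact congrArg f (map_refl (s := Y))
  map_mul' g h := by
    refine LinearMap.ext fun f => funext fun Y => ?_
    simp only [LinearMap.funLeft_apply, Module.End.mul_apply, map_map]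
    rfl

/-- The boundary map of the simplex with vertices `α`, modulo two. -/
def boundary : (Finset α → k) →ₗ[k] (Finset α → k) where
  toFun f Y := ∑ y ∈ Yᶜ, f (insert y Y)
  map_add' f g := by ext Y; simp [sum_add_distrib]
  map_smul' a f := by ext Y; simp [mul_sum]

/-- The coboundary map of the simplex with vertices `α`, modulo two. -/
def coboundary : (Finset α → k) →ₗ[k] (Finset α → k) where
  toFun f Y := ∑ y ∈ Y, f (Y.erase y)
  map_add' f g := by ext Y; simp [sum_add_distrib]
  map_smul' a f := by ext Y; simp [mul_sum]

/-- The projection of functions of subsets to functions supported on subsets with `r` elements. -/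
def truncate (r : ℕ) : (Finset α → k) →ₗ[k] (Finset α → k) where
  toFun f Y := if #Y = r then f Y else 0
  map_add' f g := by ext Y; by_cases h : #Y = r <;> simp [h]
  map_smul' a f := by ext Y; by_cases h : #Y = r <;> simp [h]

/-- The span of the boundaries of the subsets with `r + 1` elements. -/
def boundaries (r : ℕ) : Submodule k (Finset α → k) :=
  Submodule.span k ((fun X => boundary k α (Pi.single X 1)) '' {X | #X = r + 1})

variable {k α}

theorem subsetRep_apply (g : Equiv.Perm α) (f : Finset α → k) (Y : Finset α) :
    subsetRep k α g f Y = f (Y.map g.symm.toEmbedding) := rfl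

theorem subsetRep_apply_map (g : Equiv.Perm α) (f : Finset α → k) (Y : Finset α) :
    subsetRep k α g f (Y.map g.toEmbedding) = f Y := by
  rw [subsetRep_apply, map_map]
  congr 1
  ext x
  simp

theorem boundary_apply (f : Finset α → k) (Y : Finset α) :
    boundary k α f Y = ∑ y ∈ Yᶜ, f (insert y Y) := rfl

theorem coboundary_apply (f : Finset α → k) (Y : Finset α) :
    coboundary k α f Y = ∑ y ∈ Y, f (Y.erase y) := rfl

theorem truncate_apply (r : ℕ) (f : Finset α → k) (Y : Finset α) :
    truncate k α r f Y = if #Y = r then f Y else 0 := rfl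

theorem truncate_eq_sum (r : ℕ) (f : Finset α → k) :
    truncate k α r f = ∑ X ∈ powersetCard r univ, f X • (Pi.single X 1 : Finset α → k) := by
  ext Y
  simp [Pi.single_apply, truncate_apply]

theorem subsetRep_single (g : Equiv.Perm α) (X : Finset α) :
    subsetRep k α g (Pi.single X 1) = Pi.single (X.map g.toEmbedding) 1 := by
  ext Y
  have : Y.map g.symm.toEmbedding = X ↔ Y = X.map g.toEmbedding := by
    constructor
    · rintro rfl
      ext x
      simp
    · rintro rfl
      ext x
      simp
  simp [subsetRep_apply, Pi.single_apply, this]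

theorem boundary_subsetRep (g : Equiv.Perm α) (f : Finset α → k) :
    boundary k α (subsetRep k α g f) = subsetRep k α g (boundary k α f) := by
  ext Y
  simp only [boundary_apply, subsetRep_apply, map_insert]
  refine sum_equiv g.symm (fun y => ?_) fun y _ => ?_ <;> simp

theorem coboundary_subsetRep (g : Equiv.Perm α) (f : Finset α → k) :
    coboundary k α (subsetRep k α g f) = subsetRep k α g (coboundary k α f) := by
  ext Y
  simp only [coboundary_apply, subsetRep_apply, map_erase]
  refine sum_equiv g.symm (fun y => ?_) fun y _ => ?_ <;> simp

theorem truncate_subsetRep (r : ℕ) (g : Equiv.Perm α) (f : Finset α → k) :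
    truncate k α r (subsetRep k α g f) = subsetRep k α g (truncate k α r f) := by
  ext Y
  simp [truncate_apply, subsetRep_apply]

theorem boundary_boundary [CharP k 2] (f : Finset α → k) :
    boundary k α (boundary k α f) = 0 := by
  ext Y
  simp only [boundary_apply, Pi.zero_apply]
  rw [sum_sigma']
  refine sum_involution (fun p _ => ⟨p.2, p.1⟩) ?_ ?_ ?_ ?_
  · rintro ⟨y, z⟩ _
    rw [Finset.insert_comm]
    exact CharTwo.add_self_eq_zero _
  · rintro ⟨y, z⟩ h _ h'
    simp only [mem_sigma, mem_compl, mem_insert, not_or] at h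
    simp only [Sigma.mk.injEq, heq_eq_eq] at h'
    exact h.2.1 h'.1
  · rintro ⟨y, z⟩ h
    simp only [mem_sigma, mem_compl, mem_insert, not_or] at h ⊢
    exact ⟨h.2.2, Ne.symm h.2.1, h.1⟩
  · rintro ⟨y, z⟩ _
    rfl

theorem boundary_coboundary_apply (f : Finset α → k) (Y : Finset α) :
    boundary k α (coboundary k α f) Y =
      (#Yᶜ : k) * f Y + ∑ y ∈ Yᶜ, ∑ z ∈ Y, f (insert y (Y.erase z)) := by
  rw [boundary_apply, ← nsmul_eq_mul, ← sum_const, ← sum_add_distrib]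
  refine sum_congr rfl fun y hy => ?_
  rw [mem_compl] at hy
  rw [coboundary_apply, sum_insert hy, erase_insert hy]
  congr 1
  refine sum_congr rfl fun z hz => ?_
  rw [erase_insert_of_ne]
  rintro rfl
  exact hy hz

theorem coboundary_boundary_apply (f : Finset α → k) (Y : Finset α) :
    coboundary k α (boundary k α f) Y =
      (#Y : k) * f Y + ∑ y ∈ Yᶜ, ∑ z ∈ Y, f (insert y (Y.erase z)) := by
  rw [sum_comm, coboundary_apply, ← nsmul_eq_mul, ← sum_const, ← sum_add_distrib]
  refine sum_congr rfl fun z hz => ?_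
  rw [boundary_apply, compl_erase, sum_insert (by simpa using hz), insert_erase hz]

/-- The two compositions share the same sum over exchanges of one element, which cancels mod 2; what
remains is the diagonal `#Yᶜ + #Y`. -/
theorem boundary_coboundary_add [CharP k 2] (f : Finset α → k) :
    boundary k α (coboundary k α f) + coboundary k α (boundary k α f) =
      (Fintype.card α : k) • f := by
  ext Y
  rw [Pi.add_apply, boundary_coboundary_apply, coboundary_boundary_apply, add_add_add_comm,
    CharTwo.add_self_eq_zero, add_zero, ← add_mul, ← Nat.cast_add, add_comm (#Yᶜ),
    card_add_card_compl]
  rfl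

theorem boundary_of_mem_boundaries [CharP k 2] {r : ℕ} {f : Finset α → k}
    (hf : f ∈ boundaries k α r) : boundary k α f = 0 := by
  induction hf using Submodule.span_induction with
  | mem _ h =>
    obtain ⟨X, -, rfl⟩ := h
    exact boundary_boundary _
  | zero => exact map_zero _
  | add _ _ _ _ hx hy => rw [map_add, hx, hy, add_zero]
  | smul a _ _ hx => rw [map_smul, hx, smul_zero]

theorem boundary_single_apply (X Y : Finset α) :
    boundary k α (Pi.single X 1) Y = if Y ⊆ X ∧ #X = #Y + 1 then 1 else 0 := by
  rw [boundary_apply]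
  split_ifs with h
  · obtain ⟨x, hx⟩ : ∃ x, X \ Y = {x} := by
      rw [← card_eq_one, card_sdiff_of_subset h.1]
      omega
    have hxX : x ∈ X \ Y := by simp [hx]
    rw [mem_sdiff] at hxX
    have hX : insert x Y = X := by
      rw [← union_sdiff_of_subset h.1, hx, union_comm, insert_eq]
    rw [sum_eq_single_of_mem x (by simp [hxX.2])]
    · simp [hX]
    · intro y hy hne
      rw [Pi.single_apply, if_neg]
      intro h'
      have : y ∈ X \ Y := by
        rw [mem_sdiff, ← h']
        exact ⟨mem_insert_self _ _, by simpa using hy⟩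
      rw [hx, mem_singleton] at this
      exact hne this
  · refine sum_eq_zero fun y hy => ?_
    rw [Pi.single_apply, if_neg]
    rintro rfl
    exact h ⟨subset_insert _ _, card_insert_of_notMem (by simpa using hy)⟩

theorem boundary_single (X : Finset α) :
    boundary k α (Pi.single X 1) = ∑ x ∈ X, Pi.single (X.erase x) 1 := by
  ext Y
  rw [boundary_single_apply, Finset.sum_apply]
  simp only [Pi.single_apply]
  split_ifs with h
  · obtain ⟨x, hx⟩ : ∃ x, X \ Y = {x} := by
      rw [← card_eq_one, card_sdiff_of_subset h.1]
      omega
    have hxX : x ∈ X \ Y := by simp [hx]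
    rw [mem_sdiff] at hxX
    have hY : Y = X.erase x := by
      rw [erase_eq, ← hx, Finset.sdiff_sdiff_eq_self h.1]
    rw [sum_eq_single_of_mem x hxX.1, if_pos hY]
    intro y hy hne
    rw [if_neg]
    rintro rfl
    have : y ∈ X \ X.erase y := by simp [hy]
    rw [hx, mem_singleton] at this
    exact hne this
  · refine (sum_eq_zero fun x hx => if_neg ?_).symm
    rintro rfl
    exact h ⟨erase_subset _ _, (card_erase_add_one hx).symm⟩

theorem truncate_of_mem_boundaries {r : ℕ} {f : Finset α → k}
    (hf : f ∈ boundaries k α r) : truncate k α r f = f := by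
  induction hf using Submodule.span_induction with
  | mem _ h =>
    obtain ⟨X, hX, rfl⟩ := h
    rw [Set.mem_ofPred_eq] at hX
    ext Y
    simp only [truncate_apply, boundary_single_apply]
    split_ifs <;> first | rfl | omega
  | zero => exact map_zero _
  | add _ _ _ _ hx hy => rw [map_add, hx, hy]
  | smul a _ _ hx => rw [map_smul, hx]

theorem boundary_mem_boundaries {r : ℕ} {f : Finset α → k}
    (hf : truncate k α (r + 1) f = f) : boundary k α f ∈ boundaries k α r := by
  rw [← hf, truncate_eq_sum, map_sum]
  refine sum_mem fun X hX => ?_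
  rw [map_smul]
  exact Submodule.smul_mem _ _ (Submodule.subset_span ⟨X, (mem_powersetCard.1 hX).2, rfl⟩)

theorem truncate_coboundary_truncate (r : ℕ) (f : Finset α → k) :
    truncate k α (r + 1) (coboundary k α (truncate k α r f)) =
      coboundary k α (truncate k α r f) := by
  ext Y
  rw [truncate_apply, ite_eq_left_iff]
  intro h
  rw [coboundary_apply]
  refine (sum_eq_zero fun y hy => ?_).symm
  rw [truncate_apply, if_neg]
  have := card_erase_add_one hy
  omega

variable (k α)

/-- The projection to the boundaries, when `α` has an odd number of elements. -/
def boundaryProj (r : ℕ) : (Finset α → k) →ₗ[k] (Finset α → k) :=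
  boundary k α ∘ₗ coboundary k α ∘ₗ truncate k α r

variable {k α}

theorem boundaryProj_subsetRep (r : ℕ) (g : Equiv.Perm α) (f : Finset α → k) :
    boundaryProj k α r (subsetRep k α g f) = subsetRep k α g (boundaryProj k α r f) := by
  simp [boundaryProj, truncate_subsetRep, coboundary_subsetRep, boundary_subsetRep]

theorem boundaryProj_mem (r : ℕ) (f : Finset α → k) :
    boundaryProj k α r f ∈ boundaries k α r :=
  boundary_mem_boundaries (truncate_coboundary_truncate r f)

/-- On a cycle the term `δ∂` vanishes, so `∂δ` is multiplication by the number of points, which is 1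
in `k`. -/
theorem boundaryProj_of_mem [CharP k 2] (hα : Odd (Fintype.card α)) {r : ℕ} {f : Finset α → k}
    (hf : f ∈ boundaries k α r) : boundaryProj k α r f = f := by
  have h := boundary_coboundary_add f
  rw [boundary_of_mem_boundaries hf, map_zero, add_zero] at h
  have h1 : (Fintype.card α : k) = 1 := by
    obtain ⟨m, hm⟩ := hα
    rw [hm]
    push_cast
    rw [CharTwo.two_eq_zero, zero_mul, zero_add]
  rw [boundaryProj, LinearMap.comp_apply, LinearMap.comp_apply, truncate_of_mem_boundaries hf, h,
    h1, one_smul]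

/-- A function of pairs of subsets of fixed cardinalities that is invariant under the symmetric
group depends only on the cardinality of the intersection. -/
theorem exists_eq_apply_card_inter (K : Finset α → Finset α → k) (p q : ℕ)
    (hK : ∀ (g : Equiv.Perm α) X Y, #X = p →
      K (X.map g.toEmbedding) (Y.map g.toEmbedding) = K X Y) :
    ∃ c : ℕ → k, (∀ j, q < j → c j = 0) ∧ ∀ X Y, #X = p → #Y = q → K X Y = c #(X ∩ Y) := by
  classical
  let P (j : ℕ) (A : Finset α × Finset α) : Prop := #A.1 = p ∧ #A.2 = q ∧ #(A.1 ∩ A.2) = j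
  -- Sizes that no pair attains get the value 0, in particular all `j > q`.
  refine ⟨fun j => if h : ∃ A, P j A then K h.choose.1 h.choose.2 else 0, ?_, ?_⟩
  · intro j hj
    refine dif_neg ?_
    rintro ⟨A, -, h2, h3⟩
    have := card_le_card (inter_subset_right (s₁ := A.1) (s₂ := A.2))
    omega
  · intro X Y hX hY
    have h : ∃ A, P #(X ∩ Y) A := ⟨(X, Y), hX, hY, rfl⟩
    obtain ⟨h1, h2, h3⟩ := h.choose_spec
    obtain ⟨g, hg1, hg2⟩ := exists_perm_map_eq (hX.trans h1.symm) (hY.trans h2.symm) h3.symm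
    rw [← hK g X Y hX, hg1, hg2]
    beta_reduce
    rw [dif_pos h]

end SubsetModule

/-! ### The Johnson scheme and its dependence on the number of points. -/

section Johnson

set_option linter.unusedSectionVars false

variable {k : Type*} [Field k] {α : Type*} [Fintype α] [DecidableEq α]

variable (α) in
/-- The linear combination with coefficients `c j` of the operators of the Johnson scheme, where
the `j`th operator relates subsets with `r` elements whose intersection has `j` elements. -/
def johnson (r : ℕ) : (ℕ → k) →ₗ[k] (Finset α → k) →ₗ[k] (Finset α → k) :=
  LinearMap.mk₂ k
    (fun c f Y => if #Y = r then ∑ X ∈ powersetCard r univ, c #(X ∩ Y) * f X else 0)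
    (fun c c' f => by ext Y; by_cases h : #Y = r <;> simp [h, add_mul, sum_add_distrib])
    (fun a c f => by ext Y; by_cases h : #Y = r <;> simp [h, mul_assoc, mul_sum])
    (fun c f f' => by ext Y; by_cases h : #Y = r <;> simp [h, mul_add, sum_add_distrib])
    (fun a c f => by ext Y; by_cases h : #Y = r <;> simp [h, mul_left_comm, mul_sum])

theorem johnson_apply (r : ℕ) (c : ℕ → k) (f : Finset α → k) (Y : Finset α) :
    johnson α r c f Y =
      if #Y = r then ∑ X ∈ powersetCard r univ, c #(X ∩ Y) * f X else 0 := rfl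

theorem johnson_single {r : ℕ} {X Y : Finset α} (hX : #X = r) (hY : #Y = r) (c : ℕ → k) :
    johnson α r c (Pi.single X 1) Y = c #(X ∩ Y) := by
  simp [johnson_apply, hY, Pi.single_apply, hX]

theorem johnson_subsetRep (r : ℕ) (c : ℕ → k) (g : Equiv.Perm α) (f : Finset α → k) :
    johnson α r c (subsetRep k α g f) = subsetRep k α g (johnson α r c f) := by
  ext Y
  simp only [johnson_apply, subsetRep_apply, card_map]
  congr 1
  refine sum_equiv g.symm.finsetCongr (fun X => ?_) fun X _ => ?_
  · simp [mem_powersetCard]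
  · rw [Equiv.finsetCongr_apply, ← map_inter, card_map]

theorem johnson_eq_iff {r : ℕ} {T : (Finset α → k) →ₗ[k] (Finset α → k)}
    (h1 : ∀ f, T (truncate k α r f) = T f) (h2 : ∀ f, truncate k α r (T f) = T f) (c : ℕ → k) :
    T = johnson α r c ↔ ∀ X Y, #X = r → #Y = r → T (Pi.single X 1) Y = c #(X ∩ Y) := by
  constructor
  · rintro rfl X Y hX hY
    exact johnson_single hX hY c
  · intro h
    refine LinearMap.ext fun f => funext fun Y => ?_
    rw [johnson_apply]
    split_ifs with hY
    · rw [← h1, truncate_eq_sum, map_sum, Finset.sum_apply]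
      refine sum_congr rfl fun X hX => ?_
      rw [map_smul, Pi.smul_apply, h X Y (mem_powersetCard.1 hX).2 hY, smul_eq_mul, mul_comm]
    · rw [← h2, truncate_apply, if_neg hY]

theorem johnson_truncate (r : ℕ) (c : ℕ → k) (f : Finset α → k) :
    johnson α r c (truncate k α r f) = johnson α r c f := by
  ext Y
  simp only [johnson_apply]
  congr 1
  refine sum_congr rfl fun X hX => ?_
  rw [truncate_apply, if_pos (mem_powersetCard.1 hX).2]

theorem truncate_johnson (r : ℕ) (c : ℕ → k) (f : Finset α → k) :
    truncate k α r (johnson α r c f) = johnson α r c f := by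
  ext Y
  simp only [johnson_apply, truncate_apply]
  split_ifs <;> rfl

/-- The orbits of the symmetric group on pairs of `r`-subsets are classified by the size of the
intersection, so an equivariant matrix is constant on each class. -/
theorem exists_eq_johnson {r : ℕ} {T : (Finset α → k) →ₗ[k] (Finset α → k)}
    (h1 : ∀ f, T (truncate k α r f) = T f) (h2 : ∀ f, truncate k α r (T f) = T f)
    (h3 : ∀ g f, T (subsetRep k α g f) = subsetRep k α g (T f)) :
    ∃ c : ℕ → k, (∀ j, r < j → c j = 0) ∧ T = johnson α r c := by
  obtain ⟨c, hc, hc'⟩ := exists_eq_apply_card_inter (fun X Y => T (Pi.single X (1 : k)) Y) r r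
    (fun g X Y _ => by rw [← subsetRep_single, h3, subsetRep_apply_map])
  exact ⟨c, hc, (johnson_eq_iff h1 h2 c).2 hc'⟩

theorem exists_card_inter_eq {p q j : ℕ} (hp : j ≤ p) (hq : j ≤ q)
    (h : p + q ≤ Fintype.card α + j) :
    ∃ X Y : Finset α, #X = p ∧ #Y = q ∧ #(X ∩ Y) = j := by
  obtain ⟨X, -, hX⟩ := exists_subset_card_eq (s := (univ : Finset α)) (n := p)
    (by rw [card_univ]; omega)
  obtain ⟨A, hA, hA'⟩ := exists_subset_card_eq (s := X) (n := j) (by omega)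
  obtain ⟨B, hB, hB'⟩ := exists_subset_card_eq (s := Xᶜ) (n := q - j)
    (by rw [card_compl]; omega)
  have hXB : Disjoint X B := disjoint_of_subset_right hB disjoint_compl_right
  refine ⟨X, A ∪ B, hX, ?_, ?_⟩
  · rw [card_union_of_disjoint (disjoint_of_subset_left hA hXB)]
    omega
  · rw [inter_union_distrib_left, inter_eq_right.2 hA, disjoint_iff_inter_eq_empty.1 hXB,
      union_empty, hA']

/-- The bound on `r` makes every `j ≤ r` the intersection size of some pair, so each coefficient is
visible as a matrix entry. -/
theorem johnson_injective {r : ℕ} (hα : 2 * r ≤ Fintype.card α) {c c' : ℕ → k}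
    (hc : ∀ j, r < j → c j = 0) (hc' : ∀ j, r < j → c' j = 0)
    (h : johnson α r c = johnson α r c') : c = c' := by
  ext j
  by_cases hj : r < j
  · rw [hc j hj, hc' j hj]
  · obtain ⟨X, Y, hX, hY, hXY⟩ := exists_card_inter_eq (α := α) (p := r) (q := r) (j := j)
      (by omega) (by omega) (by omega)
    rw [← hXY, ← johnson_single hX hY c, h, johnson_single hX hY]

variable (α) in
/-- The relation `c = a * b` in the Johnson scheme, in terms of coefficients. -/
def IsJohnsonMul (r : ℕ) (a b c : ℕ → k) : Prop :=
  ∀ X Y : Finset α, #X = r → #Y = r →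
    ∑ Z ∈ powersetCard r univ, a #(Z ∩ Y) * b #(Z ∩ X) = c #(X ∩ Y)

theorem johnson_comp_johnson_eq_iff (r : ℕ) (a b c : ℕ → k) :
    johnson α r a ∘ₗ johnson α r b = johnson α r c ↔ IsJohnsonMul α r a b c := by
  rw [johnson_eq_iff]
  · refine forall₄_congr fun X Y hX hY => ?_
    rw [LinearMap.comp_apply, johnson_apply, if_pos hY]
    refine Eq.congr (sum_congr rfl fun Z hZ => ?_) rfl
    rw [johnson_single hX (mem_powersetCard.1 hZ).2, inter_comm X]
  · intro f
    rw [LinearMap.comp_apply, johnson_truncate, LinearMap.comp_apply]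
  · intro f
    rw [LinearMap.comp_apply, truncate_johnson]

/-- The subsets with `r` elements that meet `Y` in at least `r - 1` elements are `Y` itself and the
subsets that arise from `Y` by exchanging one element. -/
theorem sum_powersetCard_neighbours (r n : ℕ) {Y : Finset α} (hY : #Y = r) (f : Finset α → k) :
    ∑ X ∈ powersetCard r univ, (if #(X ∩ Y) = r then (n : k) else
      if #(X ∩ Y) + 1 = r then 1 else 0) * f X =
    n * f Y + ∑ y ∈ Yᶜ, ∑ z ∈ Y, f (insert y (Y.erase z)) := by
  have hYm : Y ∈ powersetCard r univ := mem_powersetCard.2 ⟨subset_univ _, hY⟩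
  rw [← add_sum_erase _ _ hYm, inter_self, if_pos hY]
  congr 1
  rw [← sum_product']
  have hsub (X : Finset α) (hX : X ∈ (powersetCard r univ).erase Y) : #(X ∩ Y) ≠ r := by
    rw [mem_erase, mem_powersetCard] at hX
    intro h
    have h1 : X ∩ Y = X := eq_of_subset_of_card_le inter_subset_left (by omega)
    have h2 : X ∩ Y = Y := eq_of_subset_of_card_le inter_subset_right (by omega)
    exact hX.1 (h1.symm.trans h2)
  rw [← sum_filter_of_ne (p := fun X => #(X ∩ Y) + 1 = r)]
  · symm
    refine sum_bij (fun p _ => insert p.1 (Y.erase p.2)) ?_ ?_ ?_ ?_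
    · rintro ⟨y, z⟩ h
      simp only [mem_product, mem_compl] at h
      have hne : y ≠ z := by rintro rfl; exact h.1 h.2
      have h1 := card_erase_add_one h.2
      simp only [mem_filter, mem_erase, mem_powersetCard]
      refine ⟨⟨?_, subset_univ _, ?_⟩, ?_⟩
      · intro h'
        exact h.1 (h' ▸ mem_insert_self _ _)
      · rw [card_insert_of_notMem (by simp [h.1])]
        omega
      · rw [insert_inter_of_notMem h.1, inter_eq_left.2 (erase_subset _ _)]
        omega
    · rintro ⟨y, z⟩ h ⟨y', z'⟩ h' he
      simp only [mem_product, mem_compl] at h h'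
      have e1 : y = y' := by
        have : y ∈ insert y' (Y.erase z') := he ▸ mem_insert_self _ _
        simpa [h.1] using this
      have e2 : z = z' := by
        by_contra hne
        have h2 : z ∈ insert y (Y.erase z) := he ▸ mem_insert_of_mem (mem_erase.2 ⟨hne, h.2⟩)
        rw [mem_insert] at h2
        rcases h2 with rfl | h2
        · exact h.1 h.2
        · simp at h2
      rw [e1, e2]
    · intro X hX
      simp only [mem_filter, mem_erase, mem_powersetCard] at hX
      obtain ⟨⟨hne, -, hX⟩, hXY⟩ := hX
      obtain ⟨y, hy⟩ : ∃ y, X \ Y = {y} := by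
        rw [← card_eq_one]
        have := card_sdiff_add_card_inter X Y
        omega
      obtain ⟨z, hz⟩ : ∃ z, Y \ X = {z} := by
        rw [← card_eq_one]
        have := card_sdiff_add_card_inter Y X
        rw [inter_comm Y X] at this
        omega
      have hy' : y ∈ X \ Y := by simp [hy]
      have hz' : z ∈ Y \ X := by simp [hz]
      rw [mem_sdiff] at hy' hz'
      refine ⟨(y, z), by simp [hy'.2, hz'.1], ?_⟩
      ext x
      have h1 : x ∈ X \ Y ↔ x = y := by rw [hy, mem_singleton]
      have h2 : x ∈ Y \ X ↔ x = z := by rw [hz, mem_singleton]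
      simp only [mem_sdiff] at h1 h2
      simp only [mem_insert, mem_erase]
      tauto
    · rintro ⟨y, z⟩ h
      simp only [mem_product, mem_compl] at h
      have h1 : #(Y.erase z) + 1 = #Y := card_erase_add_one h.2
      have h2 : #(insert y (Y.erase z) ∩ Y) = #(Y.erase z) := by
        rw [insert_inter_of_notMem h.1, inter_eq_left.2 (erase_subset _ _)]
      rw [h2, if_neg (by omega), if_pos (by omega), one_mul]
  · intro X hX h
    by_contra h'
    rw [if_neg (hsub X hX), if_neg h', zero_mul] at h
    exact h rfl

/-- The coefficients of the projection to the boundaries in the Johnson scheme. -/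
def projCoeff (k : Type*) [Field k] (n r j : ℕ) : k :=
  if j = r then ((n - r : ℕ) : k) else if j + 1 = r then 1 else 0

theorem boundaryProj_eq_johnson (r : ℕ) :
    boundaryProj k α r = johnson α r (projCoeff k (Fintype.card α) r) := by
  refine LinearMap.ext fun f => funext fun Y => ?_
  rw [boundaryProj, LinearMap.comp_apply, LinearMap.comp_apply, ← johnson_truncate,
    boundary_coboundary_apply, johnson_apply]
  split_ifs with hY
  · rw [card_compl, hY]
    exact (sum_powersetCard_neighbours r _ hY _).symm
  · rw [truncate_apply, if_neg hY, mul_zero, zero_add]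
    refine sum_eq_zero fun y hy => sum_eq_zero fun z hz => ?_
    rw [mem_compl] at hy
    have h1 := card_erase_add_one hz
    rw [truncate_apply, card_insert_of_notMem (by simp [hy]), if_neg (by omega)]

theorem projCoeff_of_lt {n r j : ℕ} (h : r < j) : projCoeff k n r j = 0 := by
  rw [projCoeff, if_neg (by omega), if_neg (by omega)]

theorem projCoeff_add_even [CharP k 2] {n N r : ℕ} (hn : r ≤ n) (hN : Even N) :
    projCoeff k (n + N) r = projCoeff k n r := by
  have : ((n + N - r : ℕ) : k) = ((n - r : ℕ) : k) := by
    rw [Nat.sub_add_comm hn, Nat.cast_add, (CharP.cast_eq_zero_iff k 2 N).2 hN.two_dvd, add_zero]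
  ext j
  rw [projCoeff, projCoeff, this]

/-- A sum over the subsets of `β` with `r` elements of a quantity that only depends on the
intersection with the image of `α` is a sum over the subsets of `α`. -/
theorem sum_powersetCard_preimage {β : Type*} [Fintype β] [DecidableEq β] (i : α ↪ β) {N : ℕ}
    (hN : Fintype.card β = Fintype.card α + N) (r : ℕ) (G : Finset α → k) :
    ∑ Z ∈ powersetCard r univ, G (Z.preimage i i.injective.injOn) =
      ∑ A : Finset α, if #A ≤ r then (N.choose (r - #A) : k) * G A else 0 := by
  rw [← sum_fiberwise (g := fun Z : Finset β => Z.preimage i i.injective.injOn)]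
  refine sum_congr rfl fun A _ => ?_
  -- The sets with preimage `A` are `A.map i ∪ B` with `B` among the `N` new points, which leaves
  -- `N.choose (r - #A)` choices.
  have hpre (B : Finset β) (hB : B ⊆ (univ.map i)ᶜ) :
      (A.map i ∪ B).preimage i i.injective.injOn = A := by
    ext x
    have : i x ∉ B := fun h => by simpa using hB h
    rw [mem_preimage, mem_union, or_iff_left this, mem_map']
  have hdisj (B : Finset β) (hB : B ⊆ (univ.map i)ᶜ) : Disjoint (A.map i) B :=
    disjoint_of_subset_left (map_subset_map.2 (subset_univ _))
      (disjoint_of_subset_right hB disjoint_compl_right)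
  rw [sum_congr rfl (g := fun _ => G A) fun Z hZ => by rw [(mem_filter.1 hZ).2], sum_const,
    nsmul_eq_mul]
  have hcard : #(univ.map i)ᶜ = N := by
    rw [card_compl, card_map, card_univ, hN]
    omega
  have hdec (Z : Finset β) (hZ : Z.preimage i i.injective.injOn = A) :
      A.map i ∪ (Z \ A.map i) = Z ∧ Z \ A.map i ⊆ (univ.map i)ᶜ := by
    subst hZ
    constructor
    · refine union_sdiff_of_subset fun x hx => ?_
      obtain ⟨y, hy, rfl⟩ := mem_map.1 hx
      simpa using hy
    · intro x hx
      rw [mem_sdiff] at hx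
      rw [mem_compl]
      intro h
      obtain ⟨y, -, rfl⟩ := mem_map.1 h
      exact hx.2 (mem_map_of_mem _ (by simpa using hx.1))
  split_ifs with h
  · congr 2
    rw [← hcard, ← card_powersetCard]
    symm
    refine card_bij (fun B _ => A.map i ∪ B) ?_ ?_ ?_
    · intro B hB
      rw [mem_powersetCard] at hB
      rw [mem_filter, mem_powersetCard, card_union_of_disjoint (hdisj B hB.1), card_map]
      exact ⟨⟨subset_univ _, by omega⟩, hpre B hB.1⟩
    · intro B hB B' hB' he
      rw [mem_powersetCard] at hB hB'
      rw [← union_sdiff_cancel_left (hdisj B hB.1), he, union_sdiff_cancel_left (hdisj B' hB'.1)]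
    · intro Z hZ
      rw [mem_filter, mem_powersetCard] at hZ
      obtain ⟨h1, h2⟩ := hdec Z hZ.2
      refine ⟨Z \ A.map i, ?_, h1⟩
      rw [mem_powersetCard]
      refine ⟨h2, ?_⟩
      have := card_union_of_disjoint (hdisj _ h2)
      rw [h1, hZ.1.2, card_map] at this
      omega
  · rw [card_eq_zero.2, Nat.cast_zero, zero_mul]
    refine filter_eq_empty_iff.2 fun Z hZ hZA => h ?_
    obtain ⟨h1, h2⟩ := hdec Z hZA
    have := card_union_of_disjoint (hdisj _ h2)
    rw [h1, (mem_powersetCard.1 hZ).2, card_map] at this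
    omega

/-- Adding `N` points does not change the multiplication of the Johnson scheme if all the
additional contributions come with an even multiplicity or vanish. -/
theorem sum_mul_map_eq {β : Type*} [Fintype β] [DecidableEq β] (i : α ↪ β) {N : ℕ}
    (hN : Fintype.card β = Fintype.card α + N) {r : ℕ} (a b : ℕ → k) {X Y : Finset α}
    (h : ∀ A : Finset α, #A < r →
      (N.choose (r - #A) : k) = 0 ∨ a #(A ∩ Y) * b #(A ∩ X) = 0) :
    ∑ Z ∈ powersetCard r univ, a #(Z ∩ Y.map i) * b #(Z ∩ X.map i) =
      ∑ Z ∈ powersetCard r univ, a #(Z ∩ Y) * b #(Z ∩ X) := by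
  have hcard (Z : Finset β) (X : Finset α) :
      #(Z ∩ X.map i) = #(Z.preimage i i.injective.injOn ∩ X) := by
    rw [← card_map i]
    congr 1
    ext x
    simp only [mem_inter, mem_map, mem_preimage]
    constructor
    · rintro ⟨h, y, hy, rfl⟩
      exact ⟨y, ⟨h, hy⟩, rfl⟩
    · rintro ⟨y, ⟨h, hy⟩, rfl⟩
      exact ⟨h, y, hy, rfl⟩
  simp only [hcard]
  rw [sum_powersetCard_preimage i hN r fun A => a #(A ∩ Y) * b #(A ∩ X),
    powersetCard_eq_filter, powerset_univ, sum_filter]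
  refine sum_congr rfl fun A _ => ?_
  rcases lt_trichotomy (#A) r with hA | hA | hA
  · rw [if_pos hA.le, if_neg hA.ne, mul_eq_zero]
    exact h A hA
  · simp [hA]
  · rw [if_neg hA.not_ge, if_neg hA.ne']

/-- A structure constant can be computed on any pair with the given intersection, and the pair can
be taken inside a copy of `α`. -/
theorem isJohnsonMul_congr {β : Type*} [Fintype β] [DecidableEq β] {N : ℕ}
    (hN : Fintype.card β = Fintype.card α + N) {r : ℕ} (hα : 2 * r ≤ Fintype.card α)
    (a b c : ℕ → k)
    (h : ∀ X Y A : Finset α, #X = r → #Y = r → #A < r →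
      (N.choose (r - #A) : k) = 0 ∨ a #(A ∩ Y) * b #(A ∩ X) = 0) :
    IsJohnsonMul α r a b c ↔ IsJohnsonMul β r a b c := by
  constructor
  · intro H X Y hX hY
    -- Since `#(X ∪ Y) ≤ 2r`, both sets lie in a subset `D` of the size of `α`.
    obtain ⟨D, hD, hD'⟩ := exists_superset_card_eq (s := X ∪ Y) (n := Fintype.card α)
      ((card_union_le X Y).trans (by omega)) (by omega)
    let e : α ≃ D := Fintype.equivOfCardEq (by simp [hD'])
    let i : α ↪ β := e.toEmbedding.trans (Function.Embedding.subtype _)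
    have hi (A : Finset β) (hA : A ⊆ D) :
        (A.preimage i i.injective.injOn).map i = A := by
      rw [map_eq_image, image_preimage, filter_true_of_mem]
      intro x hx
      exact ⟨e.symm ⟨x, hA hx⟩, by simp [i]⟩
    have hXi := hi X (subset_union_left.trans hD)
    have hYi := hi Y (subset_union_right.trans hD)
    have hX' := hX
    have hY' := hY
    rw [← hXi, card_map] at hX'
    rw [← hYi, card_map] at hY'
    rw [← hXi, ← hYi, sum_mul_map_eq i hN a b fun A hA => h _ _ A hX' hY' hA, H _ _ hX' hY',
      ← map_inter, card_map]
  · intro H X Y hX hY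
    obtain ⟨i⟩ : Nonempty (α ↪ β) := Function.Embedding.nonempty_of_card_le (by omega)
    rw [← sum_mul_map_eq i hN a b fun A hA => h _ _ A hX hY hA,
      H _ _ (by rwa [card_map]) (by rwa [card_map]), ← map_inter, card_map]

end Johnson

/-! ### Indecomposability in terms of endomorphisms. -/

namespace Representation

variable {k G V : Type*} [Field k] [Group G] [AddCommGroup V] [Module k V]

/-- An idempotent splits the module into its range and kernel; conversely the projection along an
invariant complement is equivariant. -/
theorem isIndecomposable_iff_forall_idempotent (ρ : Representation k G V) :
    ρ.IsIndecomposable ↔ Nontrivial V ∧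
      ∀ φ : IntertwiningMap ρ ρ, φ.comp φ = φ → φ = 0 ∨ φ = IntertwiningMap.id ρ := by
  have hcompl (U W : Subrepresentation ρ) :
      IsCompl U W ↔ IsCompl U.toSubmodule W.toSubmodule := by
    simp only [isCompl_iff, disjoint_iff, codisjoint_iff,
      ← Subrepresentation.toSubmodule_injective.eq_iff]
    rfl
  refine and_congr_right fun _ => ⟨fun h φ hφ => ?_, fun h U W hUW => ?_⟩
  · have hφ' : IsIdempotentElem φ.toLinearMap := congrArg IntertwiningMap.toLinearMap hφ
    rcases h φ.range φ.ker ((hcompl _ _).2 (LinearMap.IsIdempotentElem.isCompl hφ')) with h | h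
    · left
      exact IntertwiningMap.ext (LinearMap.range_eq_bot.1 (congrArg (·.toSubmodule) h))
    · right
      have hinj : Function.Injective φ.toLinearMap :=
        LinearMap.ker_eq_bot.1 (congrArg (·.toSubmodule) h)
      refine IntertwiningMap.ext (LinearMap.ext fun v => hinj ?_)
      exact LinearMap.congr_fun hφ' v
  · have hc := (hcompl U W).1 hUW
    let P := U.toSubmodule.projection W.toSubmodule hc
    let φ : IntertwiningMap ρ ρ := P.intertwiningMap_of_isIntertwiningMap ρ ρ fun g v => by
      obtain ⟨u, hu, w, hw, rfl⟩ : ∃ u ∈ U.toSubmodule, ∃ w ∈ W.toSubmodule, u + w = v :=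
        Submodule.mem_sup.1 (hc.sup_eq_top ▸ Submodule.mem_top)
      simp only [map_add, P]
      rw [Submodule.projection_apply_of_mem_left hc hu,
        Submodule.projection_apply_of_mem_right hc hw,
        Submodule.projection_apply_of_mem_left hc (U.apply_mem_toSubmodule g hu),
        Submodule.projection_apply_of_mem_right hc (W.apply_mem_toSubmodule g hw), map_zero]
    have hφ : φ.comp φ = φ :=
      IntertwiningMap.ext (Submodule.isIdempotentElem_projection hc)
    rcases h φ hφ with h | h
    · left
      have hP : P = 0 := congrArg IntertwiningMap.toLinearMap h
      refine Subrepresentation.toSubmodule_injective ?_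
      change _ = (⊥ : Submodule k V)
      rw [← Submodule.range_projection hc]
      exact LinearMap.range_eq_bot.2 hP
    · right
      have hP : P = LinearMap.id := congrArg IntertwiningMap.toLinearMap h
      refine Subrepresentation.toSubmodule_injective ?_
      change _ = (⊥ : Submodule k V)
      rw [← Submodule.ker_projection hc]
      change LinearMap.ker P = ⊥
      rw [hP, LinearMap.ker_id]

theorem isIndecomposable_of_forall_eq_smul_id [Nontrivial V] {ρ : Representation k G V}
    (h : ∀ φ : IntertwiningMap ρ ρ, ∃ a : k, φ = a • IntertwiningMap.id ρ) :
    ρ.IsIndecomposable := by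
  rw [isIndecomposable_iff_forall_idempotent]
  refine ⟨inferInstance, fun φ hφ => ?_⟩
  obtain ⟨a, rfl⟩ := h φ
  obtain ⟨v, hv⟩ := exists_ne (0 : V)
  have hav : a • a • v = a • v := DFunLike.congr_fun hφ v
  rw [smul_smul] at hav
  have haa : a * a = a := smul_left_injective k hv hav
  rcases IsIdempotentElem.iff_eq_zero_or_one.1 haa with rfl | rfl
  · exact Or.inl (zero_smul _ _)
  · exact Or.inr (one_smul _ _)

theorem finrank_intertwiningMap_of_forall_eq_smul_id [Nontrivial V] {ρ : Representation k G V}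
    (h : ∀ φ : IntertwiningMap ρ ρ, ∃ a : k, φ = a • IntertwiningMap.id ρ) :
    Module.finrank k (IntertwiningMap ρ ρ) = 1 := by
  refine finrank_eq_one_iff'.2 ⟨IntertwiningMap.id ρ, ?_, ?_⟩
  · intro h0
    obtain ⟨v, hv⟩ := exists_ne (0 : V)
    exact hv (DFunLike.congr_fun h0 v)
  · intro φ
    obtain ⟨a, ha⟩ := h φ
    exact ⟨a, ha.symm⟩

end Representation

/-! ### Even degree: only scalar endomorphisms. -/

section BoundaryModel

open Representation

variable {k : Type*} [Field k] {α : Type*} [Fintype α] [DecidableEq α]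
  {V : Type*} [AddCommGroup V] [Module k V]

/-- The map `i` identifies the representation `σ` with the boundaries of the subsets with `r + 1`
elements. -/
structure IsBoundaryModel (σ : Representation k (Equiv.Perm α) V) (r : ℕ)
    (i : V →ₗ[k] (Finset α → k)) : Prop where
  injective : Function.Injective i
  equivariant : ∀ g v, i (σ g v) = subsetRep k α g (i v)
  range_eq : LinearMap.range i = boundaries k α r

theorem cast_eq_zero_of_mod_two [CharP k 2] {n : ℕ} (h : n % 2 = 0) : (n : k) = 0 :=
  (CharP.cast_eq_zero_iff k 2 n).2 (Nat.dvd_of_mod_eq_zero h)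

theorem cast_eq_one_of_mod_two [CharP k 2] {n : ℕ} (h : n % 2 = 1) : (n : k) = 1 := by
  rw [← Nat.mod_add_div n 2, h]
  push_cast
  rw [CharTwo.two_eq_zero, zero_mul, add_zero]

/-- The relation between the coefficients of an invariant kernel whose values are cycles. -/
theorem coeff_relation_of_cycle {r j : ℕ} (hα : 2 * r ≤ Fintype.card α) (hj : j + 1 ≤ r)
    {K : Finset α → Finset α → k} {c : ℕ → k}
    (hc : ∀ X Y, #X = r + 1 → #Y = r → K X Y = c #(X ∩ Y))
    (hK : ∀ X, #X = r + 1 → boundary k α (K X) = 0) :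
    ((r + 1 - j : ℕ) : k) * c (j + 1) + ((Fintype.card α + j - 2 * r : ℕ) : k) * c j = 0 := by
  -- The boundary is evaluated at `Z`: adding a point of `X \ Z` raises the intersection to `j + 1`,
  -- adding one outside `X ∪ Z` keeps it at `j`. The sizes of these two sets are the coefficients.
  obtain ⟨X, Z, hX, hZ, hXZ⟩ := exists_card_inter_eq (α := α) (p := r + 1) (q := r - 1) (j := j)
    (by omega) (by omega) (by omega)
  have h := congrFun (hK X hX) Z
  have hu : Zᶜ = (X \ Z) ∪ (X ∪ Z)ᶜ := by
    ext x
    simp only [mem_compl, mem_union, mem_sdiff]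
    tauto
  have hd : Disjoint (X \ Z) (X ∪ Z)ᶜ :=
    disjoint_of_subset_left (sdiff_subset.trans subset_union_left) disjoint_compl_right
  have h1 := card_sdiff_add_card_inter X Z
  have h2 := card_union_add_card_inter X Z
  have e1 : ∑ y ∈ X \ Z, K X (insert y Z) = ((r + 1 - j : ℕ) : k) * c (j + 1) := by
    have hn : #(X \ Z) = r + 1 - j := by omega
    rw [← hn, ← nsmul_eq_mul, ← sum_const]
    refine sum_congr rfl fun y hy => ?_
    rw [mem_sdiff] at hy
    rw [hc X _ hX (by rw [card_insert_of_notMem hy.2]; omega), inter_insert_of_mem hy.1,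
      card_insert_of_notMem (by simp [hy.2]), hXZ]
  have e2 : ∑ y ∈ (X ∪ Z)ᶜ, K X (insert y Z) =
      ((Fintype.card α + j - 2 * r : ℕ) : k) * c j := by
    have hn : #(X ∪ Z)ᶜ = Fintype.card α + j - 2 * r := by
      rw [card_compl]
      omega
    rw [← hn, ← nsmul_eq_mul, ← sum_const]
    refine sum_congr rfl fun y hy => ?_
    rw [mem_compl, mem_union, not_or] at hy
    rw [hc X _ hX (by rw [card_insert_of_notMem hy.2]; omega), inter_insert_of_notMem hy.1, hXZ]
  rw [boundary_apply, hu, sum_union hd, e1, e2] at h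
  exact h

/-- The relation between the coefficients of an invariant kernel that vanishes on boundaries. -/
theorem coeff_relation_of_boundary {r j : ℕ} (hα : 2 * r + 2 ≤ Fintype.card α + j) (hj : j ≤ r)
    {K : Finset α → Finset α → k} {c : ℕ → k}
    (hc : ∀ X Y, #X = r + 1 → #Y = r → K X Y = c #(X ∩ Y))
    (hK : ∀ W, #W = r + 2 → ∑ w ∈ W, K (W.erase w) = 0) :
    (j : k) * c (j - 1) + ((r + 2 - j : ℕ) : k) * c j = 0 := by
  -- Removing from `W` a point of `Y` lowers the intersection to `j - 1`; removing any other keeps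
  -- it at `j`. For `j = 0` the factor `j` hides the truncated subtraction.
  obtain ⟨W, Y, hW, hY, hWY⟩ := exists_card_inter_eq (α := α) (p := r + 2) (q := r) (j := j)
    (by omega) (by omega) (by omega)
  have h := congrFun (hK W hW) Y
  have h1 := card_sdiff_add_card_inter W Y
  have e1 : ∑ w ∈ W ∩ Y, K (W.erase w) Y = (j : k) * c (j - 1) := by
    rw [← hWY, ← nsmul_eq_mul, ← sum_const]
    refine sum_congr rfl fun w hw => ?_
    have hw' := mem_inter.1 hw
    rw [hc _ Y (by rw [card_erase_of_mem hw'.1]; omega) hY, erase_inter, card_erase_of_mem hw]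
  have e2 : ∑ w ∈ W \ Y, K (W.erase w) Y = ((r + 2 - j : ℕ) : k) * c j := by
    have hn : #(W \ Y) = r + 2 - j := by omega
    rw [← hn, ← nsmul_eq_mul, ← sum_const]
    refine sum_congr rfl fun w hw => ?_
    rw [mem_sdiff] at hw
    rw [hc _ Y (by rw [card_erase_of_mem hw.1]; omega) hY, erase_inter,
      erase_eq_of_notMem (by simp [hw.2]), hWY]
  rw [Finset.sum_apply, ← sum_inter_add_sum_sdiff W Y, e1, e2] at h
  exact h

/-- In one parity class of `j` a recurrence has one even and one odd coefficient, so it gives `c j =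
0` outright: the cycle relation for odd `j` if `r` is even, the boundary relation for even `j` if
`r` is odd. The other relation carries this to the neighbouring `j`. -/
theorem coeff_eq_zero_of_even [CharP k 2] {r : ℕ} (hα : 2 * r ≤ Fintype.card α)
    (heven : Even (Fintype.card α)) {K : Finset α → Finset α → k} {c : ℕ → k}
    (hc : ∀ X Y, #X = r + 1 → #Y = r → K X Y = c #(X ∩ Y))
    (hK : ∀ X, #X = r + 1 → boundary k α (K X) = 0)
    (hK' : ∀ W, #W = r + 2 → ∑ w ∈ W, K (W.erase w) = 0)
    {j : ℕ} (hj : j < r) (hjα : 2 * r + 1 ≤ Fintype.card α + j) : c j = 0 := by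
  have rel1 (j : ℕ) (hj : j + 1 ≤ r) := coeff_relation_of_cycle hα hj hc hK
  have rel2 (j : ℕ) (hj : j ≤ r) (h : 2 * r + 2 ≤ Fintype.card α + j) :=
    coeff_relation_of_boundary h hj hc hK'
  rw [Nat.even_iff] at heven
  rcases Nat.mod_two_eq_zero_or_one r with hr | hr
  · have hodd (j : ℕ) (hj : j < r) (hjo : j % 2 = 1) : c j = 0 := by
      have h := rel1 j hj
      rw [cast_eq_zero_of_mod_two (n := r + 1 - j) (by omega),
        cast_eq_one_of_mod_two (by omega), zero_mul, zero_add, one_mul] at h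
      exact h
    rcases Nat.mod_two_eq_zero_or_one j with hje | hjo
    · have h := rel2 (j + 1) hj (by omega)
      rw [hodd (j + 1) (by omega) (by omega), cast_eq_one_of_mod_two (n := j + 1) (by omega),
        one_mul, mul_zero, add_zero, Nat.add_sub_cancel] at h
      exact h
    · exact hodd j hj hjo
  · have heven' (j : ℕ) (hj : j < r) (hjα : 2 * r + 1 ≤ Fintype.card α + j) (hje : j % 2 = 0) :
        c j = 0 := by
      -- As `Fintype.card α + j` is even here, the bound `2 * r + 1` improves to the required `2 * r
      -- + 2`.
      have h := rel2 j hj.le (by omega)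
      rw [cast_eq_zero_of_mod_two hje, cast_eq_one_of_mod_two (by omega), zero_mul, zero_add,
        one_mul] at h
      exact h
    rcases Nat.mod_two_eq_zero_or_one j with hje | hjo
    · exact heven' j hj hjα hje
    · have h := rel1 j hj
      rw [heven' (j + 1) (by omega) (by omega) (by omega), mul_zero, zero_add,
        cast_eq_one_of_mod_two (by omega), one_mul] at h
      exact h

namespace IsBoundaryModel

variable {σ : Representation k (Equiv.Perm α) V} {r : ℕ} {i : V →ₗ[k] (Finset α → k)}

theorem mem_boundaries (hi : IsBoundaryModel σ r i) (v : V) : i v ∈ boundaries k α r :=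
  hi.range_eq ▸ LinearMap.mem_range_self i v

/-- On a set with an even number of elements, the endomorphisms of the boundaries are scalars. -/
theorem exists_eq_smul_id_of_even [CharP k 2] (hi : IsBoundaryModel σ r i)
    (hα : 2 * r ≤ Fintype.card α) (heven : Even (Fintype.card α)) (φ : IntertwiningMap σ σ) :
    ∃ a : k, φ = a • IntertwiningMap.id σ := by
  -- `q` is merely linear; on boundaries it inverts `i` and is therefore equivariant there.
  obtain ⟨q, hq⟩ := LinearMap.exists_leftInverse_of_injective i
    (LinearMap.ker_eq_bot.2 hi.injective)
  have hqi (v : V) : q (i v) = v := LinearMap.congr_fun hq v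
  have hiq {f : Finset α → k} (hf : f ∈ boundaries k α r) : i (q f) = f := by
    rw [← hi.range_eq] at hf
    obtain ⟨v, rfl⟩ := hf
    rw [hqi]
  have hmem {X : Finset α} (hX : #X = r + 1) :
      boundary k α (Pi.single X 1) ∈ boundaries k α r := Submodule.subset_span ⟨X, hX, rfl⟩
  let K (X : Finset α) : Finset α → k := i (φ (q (boundary k α (Pi.single X 1))))
  obtain ⟨c, -, hc⟩ := exists_eq_apply_card_inter K (r + 1) r fun g X Y hX => by
    have h : q (boundary k α (Pi.single (X.map g.toEmbedding) 1)) =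
        σ g (q (boundary k α (Pi.single X 1))) := by
      apply hi.injective
      rw [hi.equivariant, hiq (hmem hX), hiq (hmem (by rwa [card_map])), ← boundary_subsetRep,
        subsetRep_single]
    simp only [K]
    rw [h, φ.isIntertwining, hi.equivariant, subsetRep_apply_map]
  have hK (X : Finset α) (_ : #X = r + 1) : boundary k α (K X) = 0 :=
    boundary_of_mem_boundaries (hi.mem_boundaries _)
  have hK' (W : Finset α) (_ : #W = r + 2) : ∑ w ∈ W, K (W.erase w) = 0 := by
    simp only [K]
    rw [← map_sum, ← map_sum, ← map_sum, ← map_sum, ← boundary_single, boundary_boundary,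
      map_zero, map_zero, map_zero]
  have hscalar (X : Finset α) (hX : #X = r + 1) : K X = c r • boundary k α (Pi.single X 1) := by
    ext Y
    rw [Pi.smul_apply, boundary_single_apply, hX, smul_eq_mul]
    by_cases hY : #Y = r
    · rw [hc X Y hX hY, hY]
      have hle := card_le_card (inter_subset_right (s₁ := X) (s₂ := Y))
      by_cases hYX : Y ⊆ X
      · rw [inter_eq_right.2 hYX, hY, if_pos ⟨hYX, rfl⟩, mul_one]
      · rw [if_neg fun h => hYX h.1, mul_zero]
        have hlt : #(X ∩ Y) < r := by
          refine lt_of_le_of_ne (hle.trans hY.le) fun h => hYX ?_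
          rw [← eq_of_subset_of_card_le inter_subset_right (hY.trans h.symm).le]
          exact inter_subset_left
        -- The remaining bound says that `X ∪ Y`, of size `2r + 1 - j`, fits into `α`; this excludes
        -- `j = 0` when `α` has exactly `2r` points.
        refine coeff_eq_zero_of_even hα heven hc hK hK' hlt ?_
        have h1 := card_union_add_card_inter X Y
        have h2 := card_le_univ (X ∪ Y)
        omega
    · rw [if_neg (by omega), mul_zero]
      have hb : K X ∈ boundaries k α r := hi.mem_boundaries _
      rw [← truncate_of_mem_boundaries hb, truncate_apply, if_neg hY]
  refine ⟨c r, DFunLike.ext _ _ fun v => hi.injective ?_⟩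
  have h (f : Finset α → k) (hf : f ∈ boundaries k α r) : i (φ (q f)) = c r • f := by
    induction hf using Submodule.span_induction with
    | mem _ h =>
      obtain ⟨X, hX, rfl⟩ := h
      exact hscalar X hX
    | zero => simp
    | add _ _ _ _ hx hy => simp only [map_add, hx, hy, smul_add]
    | smul a _ _ hx => simp only [map_smul, hx, smul_comm a]
  have h' := h (i v) (hi.mem_boundaries v)
  rw [hqi] at h'
  rw [h', IntertwiningMap.coe_smul, Pi.smul_apply, IntertwiningMap.id_apply, map_smul]

end IsBoundaryModel

end BoundaryModel

/-! ### Odd degree: endomorphisms as a corner of the Johnson scheme. -/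

section Corner

open Representation

variable {k : Type*} [Field k] {α : Type*} [Fintype α] [DecidableEq α]
  {V : Type*} [AddCommGroup V] [Module k V]

variable (k α) in
/-- The coefficients of the elements of the Johnson scheme that are fixed by multiplication with
the projection to the boundaries on either side. -/
def johnsonCorner (r : ℕ) : Submodule k (ℕ → k) where
  carrier := {c | (∀ j, r < j → c j = 0) ∧
    boundaryProj k α r ∘ₗ johnson α r c = johnson α r c ∧
    johnson α r c ∘ₗ boundaryProj k α r = johnson α r c}
  zero_mem' := by simp
  add_mem' {c c'} h h' := by
    refine ⟨fun j hj => ?_, ?_, ?_⟩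
    · rw [Pi.add_apply, h.1 j hj, h'.1 j hj, add_zero]
    · rw [map_add, LinearMap.comp_add, h.2.1, h'.2.1]
    · rw [map_add, LinearMap.add_comp, h.2.2, h'.2.2]
  smul_mem' a c h := by
    refine ⟨fun j hj => ?_, ?_, ?_⟩
    · rw [Pi.smul_apply, h.1 j hj, smul_zero]
    · rw [map_smul, LinearMap.comp_smul, h.2.1]
    · rw [map_smul, LinearMap.smul_comp, h.2.2]

/-- This form mentions `α` only through structure constants and `projCoeff`, which can be compared
across degrees. -/
theorem mem_johnsonCorner_iff {r : ℕ} {c : ℕ → k} :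
    c ∈ johnsonCorner k α r ↔ (∀ j, r < j → c j = 0) ∧
      IsJohnsonMul α r (projCoeff k (Fintype.card α) r) c c ∧
      IsJohnsonMul α r c (projCoeff k (Fintype.card α) r) c := by
  rw [← johnson_comp_johnson_eq_iff, ← johnson_comp_johnson_eq_iff, ← boundaryProj_eq_johnson]
  rfl

theorem johnsonCorner_eq [CharP k 2] {β : Type*} [Fintype β] [DecidableEq β] {r : ℕ}
    (hα : 2 * r ≤ Fintype.card α) (hβ : Fintype.card β = Fintype.card α + 2) :
    johnsonCorner k α r = johnsonCorner k β r := by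
  -- If `#A = r - 1` the multiplicity is `2`; if `A` is smaller, it meets `X` in fewer than `r - 1`
  -- points, where the projection has coefficient 0.
  have key (A X : Finset α) (hA : #A < r) : ((Nat.choose 2 (r - #A) : ℕ) : k) = 0 ∨
      projCoeff k (Fintype.card α) r #(A ∩ X) = 0 := by
    have hle := card_le_card (inter_subset_left (s₁ := A) (s₂ := X))
    by_cases h : #A + 1 = r
    · left
      rw [show r - #A = 1 by omega]
      exact cast_eq_zero_of_mod_two rfl
    · right
      rw [projCoeff, if_neg (by omega), if_neg (by omega)]
  ext c
  rw [mem_johnsonCorner_iff, mem_johnsonCorner_iff, hβ,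
    projCoeff_add_even (by omega) even_two, isJohnsonMul_congr hβ hα, isJohnsonMul_congr hβ hα]
  · intro X Y A _ _ hA
    exact (key A X hA).imp_right fun h => by rw [h, mul_zero]
  · intro X Y A _ _ hA
    exact (key A Y hA).imp_right fun h => by rw [h, zero_mul]

theorem choose_two_pow_eq_zero [CharP k 2] {L m : ℕ} (h0 : 0 < m) (hm : m < 2 ^ L) :
    ((Nat.choose (2 ^ L) m : ℕ) : k) = 0 :=
  (CharP.cast_eq_zero_iff k 2 _).2 (Nat.prime_two.dvd_choose_pow h0.ne' hm.ne)

theorem isJohnsonMul_add_two_pow [CharP k 2] {β : Type*} [Fintype β] [DecidableEq β] {r L : ℕ}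
    (hα : 2 * r ≤ Fintype.card α) (hβ : Fintype.card β = Fintype.card α + 2 ^ L) (hr : r < 2 ^ L)
    (a b c : ℕ → k) : IsJohnsonMul α r a b c ↔ IsJohnsonMul β r a b c :=
  isJohnsonMul_congr hβ hα a b c fun X Y A _ _ hA =>
    Or.inl (choose_two_pow_eq_zero (by omega) (by omega))

namespace IsBoundaryModel

variable {σ : Representation k (Equiv.Perm α) V} {r : ℕ} {i : V →ₗ[k] (Finset α → k)}

/-- A set with an odd number of elements has an equivariant projection to the boundaries. -/
theorem exists_proj [CharP k 2] (hi : IsBoundaryModel σ r i) (hodd : Odd (Fintype.card α)) :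
    ∃ p : (Finset α → k) →ₗ[k] V, (∀ f, i (p f) = boundaryProj k α r f) ∧ (∀ v, p (i v) = v) ∧
      ∀ g f, p (subsetRep k α g f) = σ g (p f) := by
  obtain ⟨q, hq⟩ := LinearMap.exists_leftInverse_of_injective i
    (LinearMap.ker_eq_bot.2 hi.injective)
  have hqi (v : V) : q (i v) = v := LinearMap.congr_fun hq v
  have h1 (f : Finset α → k) : i (q (boundaryProj k α r f)) = boundaryProj k α r f := by
    obtain ⟨v, hv⟩ : boundaryProj k α r f ∈ LinearMap.range i :=
      hi.range_eq ▸ boundaryProj_mem r f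
    rw [← hv, hqi]
  refine ⟨q ∘ₗ boundaryProj k α r, h1, fun v => ?_, fun g f => hi.injective ?_⟩
  · rw [LinearMap.comp_apply, boundaryProj_of_mem hodd (hi.mem_boundaries v), hqi]
  · rw [hi.equivariant, LinearMap.comp_apply, LinearMap.comp_apply, h1, h1,
      boundaryProj_subsetRep]

/-- On a set with an odd number of elements, the endomorphisms of the boundaries are a corner of
the Johnson scheme. -/
theorem exists_linearEquiv_johnsonCorner [CharP k 2] (hi : IsBoundaryModel σ r i)
    (hα : 2 * r ≤ Fintype.card α) (hodd : Odd (Fintype.card α)) :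
    ∃ θ : johnsonCorner k α r ≃ₗ[k] IntertwiningMap σ σ,
      (∀ c, (θ c).comp (θ c) = θ c ↔ IsJohnsonMul α r c.1 c.1 c.1) ∧
      ∀ c, θ c = IntertwiningMap.id σ ↔ c.1 = projCoeff k (Fintype.card α) r := by
  obtain ⟨p, hip, hpi, hp⟩ := hi.exists_proj hodd
  let Θ : johnsonCorner k α r →ₗ[k] IntertwiningMap σ σ :=
    { toFun := fun c => (p ∘ₗ johnson α r c.1 ∘ₗ i).intertwiningMap_of_isIntertwiningMap σ σ
        fun g v => by simp [hi.equivariant, johnson_subsetRep, hp]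
      map_add' := fun c c' => DFunLike.ext _ _ fun v => by simp
      map_smul' := fun a c => DFunLike.ext _ _ fun v => by simp }
  have hΘ (c : johnsonCorner k α r) (v : V) : Θ c v = p (johnson α r c.1 (i v)) := rfl
  have hleft (c : johnsonCorner k α r) (f : Finset α → k) :
      boundaryProj k α r (johnson α r c.1 f) = johnson α r c.1 f :=
    LinearMap.congr_fun c.2.2.1 f
  have hright (c : johnsonCorner k α r) (f : Finset α → k) :
      johnson α r c.1 (boundaryProj k α r f) = johnson α r c.1 f :=
    LinearMap.congr_fun c.2.2.2 f
  have hiΘ (c : johnsonCorner k α r) (v : V) : i (Θ c v) = johnson α r c.1 (i v) := by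
    rw [hΘ, hip, hleft]
  have hiΘp (c : johnsonCorner k α r) (f : Finset α → k) :
      i (Θ c (p f)) = johnson α r c.1 f := by
    rw [hiΘ, hip, hright]
  have hinj : Function.Injective Θ := by
    intro c c' h
    refine Subtype.ext (johnson_injective hα c.2.1 c'.2.1 (LinearMap.ext fun f => ?_))
    rw [← hiΘp, h, hiΘp]
  have hsurj : Function.Surjective Θ := by
    intro φ
    -- Extending `φ` through the projection gives an equivariant operator on functions of
    -- `r`-subsets, hence an element of the Johnson scheme, fixed by the projection on both sides.
    let T : (Finset α → k) →ₗ[k] (Finset α → k) := i ∘ₗ φ.toLinearMap ∘ₗ p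
    have hT (f : Finset α → k) : T f = i (φ (p f)) := rfl
    have hTtr (f : Finset α → k) : T (truncate k α r f) = T f := by
      have : p (truncate k α r f) = p f := by
        apply hi.injective
        rw [hip, hip, boundaryProj_eq_johnson, johnson_truncate]
      rw [hT, this, hT]
    obtain ⟨c, hc, hTc⟩ := exists_eq_johnson (T := T) (r := r) hTtr
      (fun f => truncate_of_mem_boundaries (hi.mem_boundaries _))
      (fun g f => by rw [hT, hp, φ.isIntertwining, hi.equivariant, hT])
    have hmem : c ∈ johnsonCorner k α r := by
      refine ⟨hc, ?_, ?_⟩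
      · rw [← hTc]
        exact LinearMap.ext fun f => boundaryProj_of_mem hodd (hi.mem_boundaries _)
      · rw [← hTc]
        refine LinearMap.ext fun f => ?_
        rw [LinearMap.comp_apply, hT, hT, ← hip, hpi]
    refine ⟨⟨c, hmem⟩, DFunLike.ext _ _ fun v => ?_⟩
    rw [hΘ]
    change p (johnson α r c (i v)) = _
    rw [← hTc, hT, hpi, hpi]
  refine ⟨LinearEquiv.ofBijective Θ ⟨hinj, hsurj⟩, fun c => ?_, fun c => ?_⟩
  · change (Θ c).comp (Θ c) = Θ c ↔ _
    rw [← johnson_comp_johnson_eq_iff]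
    constructor
    · intro h
      refine LinearMap.ext fun f => ?_
      have := DFunLike.congr_fun h (p f)
      rw [← hiΘp, ← this, LinearMap.comp_apply, ← hiΘp, ← hiΘp, hpi]
      rfl
    · intro h
      refine DFunLike.ext _ _ fun v => hi.injective ?_
      rw [IntertwiningMap.comp_apply, hiΘ, hiΘ]
      exact LinearMap.congr_fun h _
  · change Θ c = _ ↔ _
    constructor
    · intro h
      refine johnson_injective hα c.2.1 (fun j hj => projCoeff_of_lt hj) ?_
      rw [← boundaryProj_eq_johnson]
      refine LinearMap.ext fun f => ?_
      rw [← hiΘp, h, IntertwiningMap.id_apply, hip]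
    · intro h
      refine DFunLike.ext _ _ fun v => hi.injective ?_
      rw [hiΘ, h, ← boundaryProj_eq_johnson, boundaryProj_of_mem hodd (hi.mem_boundaries v)]
      rfl

theorem finrank_eq_of_odd [CharP k 2] (hi : IsBoundaryModel σ r i)
    (hα : 2 * r ≤ Fintype.card α) (hodd : Odd (Fintype.card α)) :
    Module.finrank k (IntertwiningMap σ σ) = Module.finrank k (johnsonCorner k α r) := by
  obtain ⟨θ, -⟩ := hi.exists_linearEquiv_johnsonCorner hα hodd
  exact θ.symm.finrank_eq

theorem isIndecomposable_iff_of_odd [CharP k 2] [Nontrivial V] (hi : IsBoundaryModel σ r i)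
    (hα : 2 * r ≤ Fintype.card α) (hodd : Odd (Fintype.card α)) :
    σ.IsIndecomposable ↔ ∀ c ∈ johnsonCorner k α r, IsJohnsonMul α r c c c →
      c = 0 ∨ c = projCoeff k (Fintype.card α) r := by
  obtain ⟨θ, h1, h2⟩ := hi.exists_linearEquiv_johnsonCorner hα hodd
  rw [isIndecomposable_iff_forall_idempotent, and_iff_right ‹_›, θ.surjective.forall]
  simp only [h1, h2, Subtype.forall, EmbeddingLike.map_eq_zero_iff, Submodule.mk_eq_zero]

end IsBoundaryModel

end Corner

theorem subsetRep_mem_boundaries {k α : Type*} [Field k] [Fintype α] [DecidableEq α] {r : ℕ}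
    (g : Equiv.Perm α) {f : Finset α → k} (hf : f ∈ boundaries k α r) :
    subsetRep k α g f ∈ boundaries k α r := by
  induction hf using Submodule.span_induction with
  | mem _ h =>
    obtain ⟨X, hX, rfl⟩ := h
    refine Submodule.subset_span ⟨X.map g.toEmbedding, (card_map _).trans hX, ?_⟩
    simp only
    rw [← subsetRep_single, boundary_subsetRep]
  | zero => rw [map_zero]; exact zero_mem _
  | add _ _ _ _ hx hy => rw [map_add]; exact add_mem hx hy
  | smul a _ _ hx => rw [map_smul]; exact Submodule.smul_mem _ a hx

theorem IsBoundaryModel.nontrivial {k α V : Type*} [Field k] [Fintype α] [DecidableEq α]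
    [AddCommGroup V] [Module k V] {σ : Representation k (Equiv.Perm α) V} {r : ℕ}
    {i : V →ₗ[k] (Finset α → k)} (hi : IsBoundaryModel σ r i) (hr : r + 1 ≤ Fintype.card α) :
    Nontrivial V := by
  obtain ⟨X, -, hX⟩ := exists_subset_card_eq (s := (univ : Finset α)) (n := r + 1)
    (by rwa [card_univ])
  obtain ⟨Y, hYX, hY⟩ := exists_subset_card_eq (s := X) (n := r) (by omega)
  obtain ⟨v, hv⟩ : boundary k α (Pi.single X 1) ∈ LinearMap.range i :=
    hi.range_eq ▸ Submodule.subset_span ⟨X, hX, rfl⟩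
  refine nontrivial_of_ne v 0 ?_
  rintro rfl
  have := congrFun hv Y
  rw [boundary_single_apply, if_pos ⟨hYX, by omega⟩, map_zero] at this
  exact zero_ne_one this

/-! ### Hook Specht modules as spaces of boundaries. -/

section Hook

variable {a r n : ℕ} {h : r = 0 ∨ 1 ≤ a}

theorem mem_hookDiagram (ha : 1 ≤ a) {c : ℕ × ℕ} :
    c ∈ hookDiagram a r h ↔ c.1 = 0 ∧ c.2 < a ∨ c.2 = 0 ∧ c.1 ≤ r := by
  obtain ⟨i, j⟩ := c
  rw [hookDiagram, YoungDiagram.mem_ofRowLens]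
  cases i with
  | zero =>
    simp
    omega
  | succ i =>
    simp
    omega

theorem hookDiagram_rowLen_zero (ha : 1 ≤ a) : (hookDiagram a r h).rowLen 0 = a := by
  refine eq_of_forall_lt_iff fun j => ?_
  rw [← YoungDiagram.mem_iff_lt_rowLen, mem_hookDiagram ha]
  simp only [true_and]
  omega

theorem hookDiagram_rowLen_le_one (ha : 1 ≤ a) {i : ℕ} (hi : i ≠ 0) :
    (hookDiagram a r h).rowLen i ≤ 1 := by
  by_contra! hlt
  rw [← YoungDiagram.mem_iff_lt_rowLen, mem_hookDiagram ha] at hlt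
  simp only at hlt
  omega

theorem hookDiagram_colLen_zero (ha : 1 ≤ a) : (hookDiagram a r h).colLen 0 = r + 1 := by
  refine eq_of_forall_lt_iff fun j => ?_
  rw [← YoungDiagram.mem_iff_lt_colLen, mem_hookDiagram ha]
  simp only [true_and]
  omega

theorem card_cells_hookDiagram (ha : 1 ≤ a) : #(hookDiagram a r h).cells = a + r := by
  have : (hookDiagram a r h).cells = ({0} ×ˢ range a) ∪ (Icc 1 r ×ˢ {0}) := by
    ext ⟨i, j⟩
    rw [YoungDiagram.mem_cells, mem_hookDiagram ha]
    simp
    omega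
  rw [this, card_union_of_disjoint]
  · simp
  · rw [disjoint_left]
    rintro ⟨i, j⟩ h1 h2
    simp only [mem_product, mem_singleton, mem_Icc] at h1 h2
    omega

theorem nonempty_tableau_hookDiagram (ha : 1 ≤ a) (hn : a + r = n) :
    Nonempty (Tableau (hookDiagram a r h) n) :=
  ⟨Fintype.equivOfCardEq
    (by rw [Fintype.card_coe, card_cells_hookDiagram ha, Fintype.card_fin, hn])⟩

/-- The set of entries of a tabloid that do not lie in the first row. -/
def Tabloid.lower {μ : YoungDiagram} (T : Tabloid μ n) : Finset (Fin n) :=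
  univ.filter fun x => T.row x ≠ 0

/-- The set of entries of a tableau that lie in the first column. -/
def Tableau.firstCol {μ : YoungDiagram} (t : Tableau μ n) : Finset (Fin n) :=
  univ.filter fun x => t.col x = 0

theorem Tabloid.mem_lower {μ : YoungDiagram} {T : Tabloid μ n} {x : Fin n} :
    x ∈ T.lower ↔ T.row x ≠ 0 := by
  simp [lower]

theorem Tableau.mem_firstCol {μ : YoungDiagram} {t : Tableau μ n} {x : Fin n} :
    x ∈ t.firstCol ↔ t.col x = 0 := by
  simp [firstCol]

theorem Tabloid.lower_smul {μ : YoungDiagram} (g : Equiv.Perm (Fin n)) (T : Tabloid μ n) :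
    (g • T).lower = T.lower.map g.toEmbedding := by
  ext x
  rw [mem_map_equiv, mem_lower, mem_lower]
  rfl

theorem Tableau.firstCol_trans {μ : YoungDiagram} (g : Equiv.Perm (Fin n)) (t : Tableau μ n) :
    Tableau.firstCol (t.trans g : Tableau μ n) = t.firstCol.map g.toEmbedding := by
  ext x
  rw [mem_map_equiv, mem_firstCol, mem_firstCol]
  rfl

theorem Tableau.card_firstCol {μ : YoungDiagram} (t : Tableau μ n) :
    #t.firstCol = μ.colLen 0 := by
  rw [YoungDiagram.colLen_eq_card]
  refine card_bij (fun x _ => (t.symm x).1) ?_ ?_ ?_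
  · intro x hx
    rw [YoungDiagram.mem_col_iff]
    exact ⟨(t.symm x).2, mem_firstCol.1 hx⟩
  · intro x _ y _ hxy
    exact t.symm.injective (Subtype.ext hxy)
  · intro c hc
    rw [YoungDiagram.mem_col_iff] at hc
    refine ⟨t ⟨c, hc.1⟩, mem_firstCol.2 ?_, ?_⟩
    · rw [col, Equiv.symm_apply_apply]
      exact hc.2
    · rw [Equiv.symm_apply_apply]

theorem Tabloid.card_lower (ha : 1 ≤ a) (hn : a + r = n) (T : Tabloid (hookDiagram a r h) n) :
    #T.lower = r := by
  have h1 := card_filter_add_card_filter_not (s := (univ : Finset (Fin n))) (fun x => T.row x = 0)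
  rw [T.card_row_eq, hookDiagram_rowLen_zero ha, card_univ, Fintype.card_fin] at h1
  have h2 : #T.lower = #(univ.filter fun x => ¬ T.row x = 0) := rfl
  omega

theorem Tableau.ext_row_col {μ : YoungDiagram} (t : Tableau μ n) {x y : Fin n}
    (hr : t.row x = t.row y) (hc : t.col x = t.col y) : x = y :=
  t.symm.injective (Subtype.ext (Prod.ext hr hc))

theorem Tableau.colStabilizer_smul_injOn {μ : YoungDiagram} (t : Tableau μ n)
    {σ τ : Equiv.Perm (Fin n)} (hσ : σ ∈ t.colStabilizer) (hτ : τ ∈ t.colStabilizer)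
    (he : σ • t.tabloid = τ • t.tabloid) : σ = τ := by
  simp only [colStabilizer, mem_filter, mem_univ, true_and] at hσ hτ
  rw [← inv_inj]
  ext1 x
  refine t.ext_row_col (congrFun (congrArg Tabloid.row he) x) ?_
  have h1 := hσ (σ⁻¹ x)
  have h2 := hτ (τ⁻¹ x)
  rw [show σ (σ⁻¹ x) = x from σ.apply_symm_apply x] at h1
  rw [show τ (τ⁻¹ x) = x from τ.apply_symm_apply x] at h2
  rw [← h1, ← h2]

theorem Tableau.exists_smul_tabloid_eq_iff (ha : 1 ≤ a) (hn : a + r = n)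
    (t : Tableau (hookDiagram a r h) n) (T : Tabloid (hookDiagram a r h) n) :
    (∃ σ ∈ t.colStabilizer, σ • t.tabloid = T) ↔ T.lower ⊆ t.firstCol := by
  have hmem (x : Fin n) : (t.row x, t.col x) ∈ hookDiagram a r h := (t.symm x).2
  constructor
  · rintro ⟨σ, hσ, rfl⟩ x hx
    simp only [colStabilizer, mem_filter, mem_univ, true_and] at hσ
    rw [Tabloid.mem_lower] at hx
    have h1 := hσ (σ⁻¹ x)
    rw [show σ (σ⁻¹ x) = x from σ.apply_symm_apply x] at h1
    have h2 := hmem (σ⁻¹ x)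
    rw [mem_hookDiagram ha] at h2
    rw [mem_firstCol, h1]
    exact (h2.resolve_left fun h3 => hx h3.1).1
  · intro hT
    have hcell (x : Fin n) : (T.row x, t.col x) ∈ hookDiagram a r h := by
      by_cases hx : T.row x = 0
      · rw [hx]
        exact YoungDiagram.up_left_mem _ (Nat.zero_le _) le_rfl (hmem x)
      · rw [mem_firstCol.1 (hT (Tabloid.mem_lower.2 hx))]
        exact YoungDiagram.mem_iff_lt_colLen.2 (T.row_lt x)
    -- Each `x` goes to the entry of `t` in the column of `x` and the row prescribed by `T`; the
    -- inverse of this permutation moves the tabloid of `t` to `T`.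
    let f (x : Fin n) : Fin n := t ⟨(T.row x, t.col x), hcell x⟩
    have hrow (x : Fin n) : t.row (f x) = T.row x := by
      simp only [row, f, Equiv.symm_apply_apply]
    have hcol (x : Fin n) : t.col (f x) = t.col x := by
      simp only [f]
      rw [col, Equiv.symm_apply_apply]
    have hinj : Function.Injective f := by
      intro x y hxy
      have h1 : T.row x = T.row y := by rw [← hrow, hxy, hrow]
      have h2 : t.col x = t.col y := by rw [← hcol, hxy, hcol]
      by_cases hx : T.row x = 0
      · by_cases hc : t.col x = 0
        -- The first column has `r + 1` entries and `r` of them are below the first row of `T`, so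
        -- only one can be sent to the corner.
        · have hcard : #(t.firstCol \ T.lower) ≤ 1 := by
            rw [card_sdiff_of_subset hT, card_firstCol, hookDiagram_colLen_zero ha,
              T.card_lower ha hn]
            omega
          refine card_le_one.1 hcard x ?_ y ?_
          · rw [mem_sdiff, mem_firstCol, Tabloid.mem_lower]
            exact ⟨hc, not_not.2 hx⟩
          · rw [mem_sdiff, mem_firstCol, Tabloid.mem_lower, ← h1, ← h2]
            exact ⟨hc, not_not.2 hx⟩
        · have hz (z : Fin n) (hz : t.col z ≠ 0) : t.row z = 0 := by
            have := hmem z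
            rw [mem_hookDiagram ha] at this
            exact (this.resolve_right fun h3 => hz h3.1).1
          exact t.ext_row_col ((hz x hc).trans (hz y (h2 ▸ hc)).symm) h2
      · have hcard : #(univ.filter fun z => T.row z = T.row x) ≤ 1 := by
          rw [T.card_row_eq]
          exact hookDiagram_rowLen_le_one ha hx
        exact card_le_one.1 hcard x (by simp) y (by simp [h1])
    let e : Equiv.Perm (Fin n) := Equiv.ofBijective f (Finite.injective_iff_bijective.1 hinj)
    refine ⟨e⁻¹, ?_, ?_⟩
    · simp only [colStabilizer, mem_filter, mem_univ, true_and]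
      intro x
      have h1 : f (e⁻¹ x) = x := e.apply_symm_apply x
      rw [← hcol, h1]
    · apply Tabloid.ext
      funext x
      rw [Tabloid.smul_row, inv_inv]
      exact hrow x

variable {k : Type*} [Field k]

/-- All signs are 1, and distinct column permutations give distinct tabloids, so no coefficient
exceeds 1. -/
theorem polytabloid_apply [CharP k 2] {μ : YoungDiagram} (t : Tableau μ n) (T : Tabloid μ n)
    [Decidable (∃ σ ∈ t.colStabilizer, σ • t.tabloid = T)] :
    polytabloid k t T = if ∃ σ ∈ t.colStabilizer, σ • t.tabloid = T then 1 else 0 := by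
  classical
  have hsign (σ : Equiv.Perm (Fin n)) : ((Equiv.Perm.sign σ : ℤ) : k) = 1 := by
    rcases Int.units_eq_one_or (Equiv.Perm.sign σ) with h | h <;> simp [h, CharTwo.neg_eq]
  simp only [polytabloid, hsign, one_smul, Finsupp.finsetSum_apply, Finsupp.single_apply]
  split_ifs with h
  · obtain ⟨σ, hσ, rfl⟩ := h
    rw [sum_eq_single_of_mem σ hσ, if_pos rfl]
    intro τ hτ hne
    exact if_neg fun he => hne (t.colStabilizer_smul_injOn hτ hσ he)
  · exact sum_eq_zero fun σ hσ => if_neg fun he => h ⟨σ, hσ, he⟩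

variable (k) in
/-- The map from functions of subsets to the permutation module on tabloids that forgets the order
of the rows other than the first. -/
noncomputable def lowerMap (μ : YoungDiagram) (n : ℕ) :
    (Finset (Fin n) → k) →ₗ[k] (Tabloid μ n →₀ k) :=
  (Finsupp.linearEquivFunOnFinite k k (Tabloid μ n)).symm.toLinearMap ∘ₗ
    LinearMap.funLeft k k Tabloid.lower

theorem lowerMap_apply {μ : YoungDiagram} (f : Finset (Fin n) → k) (T : Tabloid μ n) :
    lowerMap k μ n f T = f T.lower := rfl

theorem tabloidRep_apply {μ : YoungDiagram} (g : Equiv.Perm (Fin n)) (v : Tabloid μ n →₀ k)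
    (T : Tabloid μ n) : tabloidRep k μ n g v T = v (g⁻¹ • T) := by
  conv_lhs => rw [← smul_inv_smul g T]
  exact Finsupp.mapDomain_apply (MulAction.injective g) v _

theorem tabloidRep_lowerMap {μ : YoungDiagram} (g : Equiv.Perm (Fin n))
    (f : Finset (Fin n) → k) :
    tabloidRep k μ n g (lowerMap k μ n f) = lowerMap k μ n (subsetRep k (Fin n) g f) := by
  ext T
  rw [tabloidRep_apply, lowerMap_apply, lowerMap_apply, Tabloid.lower_smul]
  rfl

theorem polytabloid_eq_lowerMap [CharP k 2] (ha : 1 ≤ a) (hn : a + r = n)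
    (t : Tableau (hookDiagram a r h) n) :
    polytabloid k t = lowerMap k _ n (boundary k (Fin n) (Pi.single t.firstCol 1)) := by
  classical
  ext T
  rw [polytabloid_apply, lowerMap_apply, boundary_single_apply]
  congr 1
  rw [t.exists_smul_tabloid_eq_iff ha hn, t.card_firstCol, hookDiagram_colLen_zero ha,
    T.card_lower ha hn, and_iff_left rfl]

theorem exists_tableau_firstCol_eq (ha : 1 ≤ a) (hn : a + r = n) {X : Finset (Fin n)}
    (hX : #X = r + 1) : ∃ t : Tableau (hookDiagram a r h) n, t.firstCol = X := by
  obtain ⟨t⟩ := nonempty_tableau_hookDiagram (h := h) ha hn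
  have hc : #t.firstCol = #X := by rw [t.card_firstCol, hookDiagram_colLen_zero ha, hX]
  obtain ⟨g, hg, -⟩ := exists_perm_map_eq hc hc (by rwa [inter_self, inter_self])
  exact ⟨t.trans g, (t.firstCol_trans g).trans hg⟩

theorem exists_tabloid_lower_eq (ha : 1 ≤ a) (hn : a + r = n) {Y : Finset (Fin n)}
    (hY : #Y = r) : ∃ T : Tabloid (hookDiagram a r h) n, T.lower = Y := by
  obtain ⟨t⟩ := nonempty_tableau_hookDiagram (h := h) ha hn
  have hc : #t.tabloid.lower = #Y := by rw [Tabloid.card_lower ha hn, hY]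
  obtain ⟨g, hg, -⟩ := exists_perm_map_eq hc hc (by rwa [inter_self, inter_self])
  exact ⟨g • t.tabloid, (t.tabloid.lower_smul g).trans hg⟩

theorem map_lowerMap_boundaries [CharP k 2] (ha : 1 ≤ a) (hn : a + r = n) :
    (boundaries k (Fin n) r).map (lowerMap k (hookDiagram a r h) n) =
      (spechtSubrep k (hookDiagram a r h) n).toSubmodule := by
  rw [boundaries, Submodule.map_span, spechtSubrep, ← Set.image_comp]
  congr 1
  ext v
  constructor
  · rintro ⟨X, hX, rfl⟩
    obtain ⟨t, rfl⟩ := exists_tableau_firstCol_eq (h := h) ha hn hX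
    exact ⟨t, polytabloid_eq_lowerMap ha hn t⟩
  · rintro ⟨t, rfl⟩
    exact ⟨t.firstCol, t.card_firstCol.trans (hookDiagram_colLen_zero ha),
      (polytabloid_eq_lowerMap ha hn t).symm⟩

/-- `lowerMap` only sees values at `r`-subsets, each of which occurs as some `Tabloid.lower`;
boundaries are supported there. -/
theorem lowerMap_injOn (ha : 1 ≤ a) (hn : a + r = n) :
    Set.InjOn (lowerMap k (hookDiagram a r h) n) (boundaries k (Fin n) r) := by
  intro f hf f' hf' he
  rw [← truncate_of_mem_boundaries hf, ← truncate_of_mem_boundaries hf']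
  ext Y
  rw [truncate_apply, truncate_apply]
  split_ifs with hY
  · obtain ⟨T, rfl⟩ := exists_tabloid_lower_eq (h := h) ha hn hY
    exact DFunLike.congr_fun he T
  · rfl

theorem exists_isBoundaryModel_spechtRep [CharP k 2] (ha : 1 ≤ a) (hn : a + r = n) :
    ∃ i : SpechtModule k (hookDiagram a r h) n →ₗ[k] (Finset (Fin n) → k),
      IsBoundaryModel (spechtRep k (hookDiagram a r h) n) r i := by
  have hmap := map_lowerMap_boundaries (k := k) (h := h) ha hn
  have hinj := lowerMap_injOn (k := k) (h := h) ha hn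
  let Φ : boundaries k (Fin n) r →ₗ[k] SpechtModule k (hookDiagram a r h) n :=
    (lowerMap k (hookDiagram a r h) n).restrict
      (q := (spechtSubrep k (hookDiagram a r h) n).toSubmodule)
      fun f hf => hmap ▸ Submodule.mem_map_of_mem hf
  have hΦ : Function.Bijective Φ := by
    constructor
    · intro f f' hff
      exact Subtype.ext (hinj f.2 f'.2 (congrArg Subtype.val hff))
    · rintro ⟨v, hv⟩
      rw [← hmap] at hv
      obtain ⟨f, hf, rfl⟩ := hv
      exact ⟨⟨f, hf⟩, rfl⟩
  let e := LinearEquiv.ofBijective Φ hΦ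
  have he (v : SpechtModule k (hookDiagram a r h) n) :
      lowerMap k (hookDiagram a r h) n (e.symm v).1 = v.1 :=
    congrArg Subtype.val (e.apply_symm_apply v)
  refine ⟨(boundaries k (Fin n) r).subtype ∘ₗ e.symm.toLinearMap, ?_, ?_, ?_⟩
  · exact Subtype.val_injective.comp e.symm.injective
  · intro g v
    refine hinj (e.symm _).2 (subsetRep_mem_boundaries g (e.symm v).2) ?_
    rw [← tabloidRep_lowerMap]
    refine (he _).trans ?_
    exact congrArg (tabloidRep k (hookDiagram a r h) n g) (he v).symm
  · rw [LinearMap.range_comp, LinearEquiv.range, Submodule.map_top, Submodule.range_subtype]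

end Hook

/-! ### Degree zero, where the boundary model fails: there are no 1-subsets, yet the Specht module
is a line. -/

section Empty

open Representation

variable {k : Type*} [Field k] {μ : YoungDiagram}

theorem nontrivial_spechtModule_zero (t : Tableau μ 0) : Nontrivial (SpechtModule k μ 0) := by
  have hmem : polytabloid k t ∈ (spechtSubrep k μ 0).toSubmodule :=
    Submodule.subset_span ⟨t, rfl⟩
  have hstab : t.colStabilizer = {1} := by
    ext σ
    simp [Tableau.colStabilizer, Subsingleton.elim σ 1]
  have hne : polytabloid k t ≠ 0 := by
    simp [polytabloid, hstab]
  refine nontrivial_of_ne (⟨polytabloid k t, hmem⟩ : SpechtModule k μ 0) 0 fun h => hne ?_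
  exact congrArg Subtype.val h

theorem exists_eq_smul_id_of_spechtRep_zero (t : Tableau μ 0)
    (φ : IntertwiningMap (spechtRep k μ 0) (spechtRep k μ 0)) :
    ∃ a : k, φ = a • IntertwiningMap.id (spechtRep k μ 0) := by
  have := nontrivial_spechtModule_zero (k := k) t
  obtain ⟨w, hw⟩ := exists_ne (0 : SpechtModule k μ 0)
  have hsub (T : Tabloid μ 0) : T = t.tabloid := Tabloid.ext (Subsingleton.elim _ _)
  have hwT : w.1 t.tabloid ≠ 0 := fun h0 =>
    hw (Subtype.ext (Finsupp.ext fun T => by rw [hsub T]; exact h0))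
  have hspan (v : SpechtModule k μ 0) : ∃ b : k, v = b • w := by
    refine ⟨v.1 t.tabloid / w.1 t.tabloid, Subtype.ext (Finsupp.ext fun T => ?_)⟩
    rw [hsub T]
    exact (div_mul_cancel₀ _ hwT).symm
  obtain ⟨a, ha⟩ := hspan (φ w)
  refine ⟨a, DFunLike.ext _ _ fun v => ?_⟩
  obtain ⟨b, rfl⟩ := hspan v
  rw [map_smul, ha, smul_comm]
  rfl

end Empty

/-! ### Endomorphisms and indecomposability of hook Specht modules by parity. -/

section Main

open Representation

variable {k : Type*} [Field k] [CharP k 2] {a r n : ℕ} {h : r = 0 ∨ 1 ≤ a}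

theorem nontrivial_spechtModule_hook (ha : 1 ≤ a) (hn : a + r = n) :
    Nontrivial (SpechtModule k (hookDiagram a r h) n) := by
  obtain ⟨i, hi⟩ := exists_isBoundaryModel_spechtRep (k := k) (h := h) ha hn
  exact hi.nontrivial (by rw [Fintype.card_fin]; omega)

theorem finrank_intertwiningMap_hook_even (hn : a + r = n) (hr : 2 * r ≤ n) (heven : Even n) :
    Module.finrank k (IntertwiningMap (spechtRep k (hookDiagram a r h) n)
      (spechtRep k (hookDiagram a r h) n)) = 1 := by
  -- Since `2 * r ≤ n`, an empty first row forces `r = n = 0`.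
  rcases Nat.eq_zero_or_pos a with ha | ha
  · obtain rfl : r = 0 := by omega
    obtain rfl : n = 0 := by omega
    subst ha
    have hcells : (hookDiagram 0 0 h).cells = ∅ := by
      ext c
      simp [hookDiagram, YoungDiagram.mem_ofRowLens]
    let t : Tableau (hookDiagram 0 0 h) 0 :=
      Fintype.equivOfCardEq (by rw [Fintype.card_coe, hcells]; rfl)
    have := nontrivial_spechtModule_zero (k := k) t
    exact finrank_intertwiningMap_of_forall_eq_smul_id (exists_eq_smul_id_of_spechtRep_zero t)
  · obtain ⟨i, hi⟩ := exists_isBoundaryModel_spechtRep (k := k) (h := h) ha hn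
    have := nontrivial_spechtModule_hook (k := k) (h := h) ha hn
    exact finrank_intertwiningMap_of_forall_eq_smul_id
      (hi.exists_eq_smul_id_of_even (by simpa using hr) (by simpa using heven))

theorem isIndecomposable_hook_even (ha : 1 ≤ a) (hn : a + r = n) (hr : 2 * r ≤ n)
    (heven : Even n) : (spechtRep k (hookDiagram a r h) n).IsIndecomposable := by
  obtain ⟨i, hi⟩ := exists_isBoundaryModel_spechtRep (k := k) (h := h) ha hn
  have := nontrivial_spechtModule_hook (k := k) (h := h) ha hn
  exact isIndecomposable_of_forall_eq_smul_id
    (hi.exists_eq_smul_id_of_even (by simpa using hr) (by simpa using heven))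

theorem finrank_intertwiningMap_hook_odd (hn : a + r = n) (hr : 2 * r ≤ n) (hodd : Odd n) :
    Module.finrank k (IntertwiningMap (spechtRep k (hookDiagram a r h) n)
      (spechtRep k (hookDiagram a r h) n)) =
        Module.finrank k (johnsonCorner k (Fin n) r) := by
  obtain ⟨m, hm⟩ := hodd
  obtain ⟨i, hi⟩ := exists_isBoundaryModel_spechtRep (k := k) (h := h) (by omega) hn
  exact hi.finrank_eq_of_odd (by simpa using hr) (by simpa using ⟨m, hm⟩)

theorem isIndecomposable_hook_odd_iff (hn : a + r = n) (hr : 2 * r ≤ n) (hodd : Odd n) :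
    (spechtRep k (hookDiagram a r h) n).IsIndecomposable ↔
      ∀ c ∈ johnsonCorner k (Fin n) r, IsJohnsonMul (Fin n) r c c c →
        c = 0 ∨ c = projCoeff k n r := by
  have ha : 1 ≤ a := by
    obtain ⟨m, hm⟩ := hodd
    omega
  obtain ⟨i, hi⟩ := exists_isBoundaryModel_spechtRep (k := k) (h := h) ha hn
  have := nontrivial_spechtModule_hook (k := k) (h := h) ha hn
  rw [hi.isIndecomposable_iff_of_odd (by simpa using hr) (by simpa using hodd), Fintype.card_fin]

end Main

theorem mainTheorem6 (k : Type*) [Field k] [CharP k 2] (d r : ℕ) (hdr : 2 * r ≤ d) :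
    Module.finrank k (Representation.IntertwiningMap
        (spechtRep k (hookDiagram (d - r) r (by omega)) d)
        (spechtRep k (hookDiagram (d - r) r (by omega)) d)) =
      Module.finrank k (Representation.IntertwiningMap
        (spechtRep k (hookDiagram (d - r + 2) r (by omega)) (d + 2))
        (spechtRep k (hookDiagram (d - r + 2) r (by omega)) (d + 2))) ∧
    ∀ L : ℕ, 1 ≤ L → 2 ^ (L - 1) ≤ r → r < 2 ^ L →
      ((spechtRep k (hookDiagram (d - r) r (by omega)) d).IsIndecomposable ↔
        (spechtRep k (hookDiagram (d - r + 2 ^ L) r (Or.inr (by have := Nat.two_pow_pos L; omega))) (d + 2 ^ L)).IsIndecomposable) := by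
  refine ⟨?_, fun L hL hrL hrL' => ?_⟩
  · rcases Nat.even_or_odd d with hd | hd
    · rw [finrank_intertwiningMap_hook_even (by omega) hdr hd,
        finrank_intertwiningMap_hook_even (by omega) (by omega) (hd.add even_two)]
    · rw [finrank_intertwiningMap_hook_odd (by omega) hdr hd,
        finrank_intertwiningMap_hook_odd (by omega) (by omega) (hd.add_even even_two),
        johnsonCorner_eq (α := Fin d) (β := Fin (d + 2)) (by simpa using hdr) (by simp)]
  · have hr : 1 ≤ r := (Nat.one_le_two_pow).trans hrL
    have hL2 : Even (2 ^ L) := (Nat.even_pow.2 ⟨even_two, by omega⟩)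
    rcases Nat.even_or_odd d with hd | hd
    · exact iff_of_true (isIndecomposable_hook_even (by omega) (by omega) hdr hd)
        (isIndecomposable_hook_even (by omega) (by omega) (by omega) (hd.add hL2))
    -- The corner conditions and idempotency are Johnson products of coefficient sequences, and the
    -- unit `projCoeff` is the same in both degrees, so the whole criterion transfers.
    · have hmul (a b c : ℕ → k) :
          IsJohnsonMul (Fin d) r a b c ↔ IsJohnsonMul (Fin (d + 2 ^ L)) r a b c :=
        isJohnsonMul_add_two_pow (by simpa using hdr) (by simp) hrL' a b c
      rw [isIndecomposable_hook_odd_iff (by omega) hdr hd,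
        isIndecomposable_hook_odd_iff (by omega) (by omega) (hd.add_even hL2)]
      simp only [mem_johnsonCorner_iff, Fintype.card_fin, hmul,
        projCoeff_add_even (show r ≤ d by omega) hL2]
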